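/- Let $c>0$ be a real constant and let $d\ge 2$ be a fixed integer. For all sufficiently large $n\in\mathbb N$ let $p=p(n)\in(0,1)$ satisfy \[ p^d n^{d-1}=\log\left(\frac{n^2}{c}\right). \] Let $G$ be the Erdős–Rényi random graph $\mathscr G(n,p)$ on the vertex set $[n]=\{1,\dots,n\}$, in which each of the $\binom n2$ possible edges is present independently with probability $p$. Let \[ W_n=\#\{(x,y)\in[n]^2 : x<y,\ d_G(x,y)>d\} \] be the number of remote pairs of $G$, where $d_G(x,y)$ is the length of a shortest path from $x$ to $y$ in $G$, and $d_G(x,y)=\infty$ if there is no such path. Then $W_n$ converges in distribution, as $n\to\infty$, to a Poisson random variable with mean $c/2$. -/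

import Mathlib

open Filter MeasureTheory ProbabilityTheory

/-- The number of remote pairs of a graph `G` on the vertex set `Fin n`: the number of pairs of
vertices `x < y` whose graph distance is greater than `d`. The distance `SimpleGraph.edist` takes
values in `ℕ∞`; it is `⊤` (so the pair is remote) when no path connects the two vertices. -/
noncomputable def remotePairs (d : ℕ) {n : ℕ} (G : SimpleGraph (Fin n)) : ℕ :=
  Set.ncard {q : Fin n × Fin n | q.1 < q.2 ∧ (d : ℕ∞) < G.edist q.1 q.2}

/-! Write `L = log (n² / c)`, so that `p ^ d * n ^ (d - 1) = L`. Two given vertices have about `n ^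
(d - 1)` potential connecting paths of length `d`, each present with probability `p ^ d`. If these
were independent, the pair would be remote with probability about `exp (-L) = c / n²`; with about
`n² / 2` pairs, the mean is `c / 2`.

Remoteness is a decreasing property of the edge set, so remoteness indicators are positively
correlated (Harris). For a sum `W` of decreasing indicators with mean `l`, this gives an approximate
Stein equation `E[W exp(itW)] ≈ l exp(it) E[exp(itW)]`, which is the differential equation of the
Poisson characteristic function. The error is governed by the squared probabilities plus the
covariances (`norm_bernoulliMeanC_sub_poisson_le`). Hence only one pair and two pairs have to be
understood; no higher moments are needed.

For one pair, Harris bounds the probability of remoteness below by the product over all potential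
paths of length at most `d` (`le_bernoulliMean_remoteInd`); only length `d` matters in the limit.
For one or two pairs, Janson's inequality on paths of length exactly `d` bounds it above
(`bernoulliMean_prod_remoteInd_le`); its correction for paths sharing edges is `O(L² / (p n))`,
which tends to zero. So one pair is remote with probability `~ c / n²`, two pairs with probability
at most `(1 + o(1)) c² / n⁴`, and the total covariance vanishes. Pairs with a common vertex need no
separate treatment. -/

set_option linter.unusedSectionVars false

/-! ### Product measure on finite subsets: the Harris and Janson inequalities. -/

section BernoulliSubsets

variable {α : Type*} [Fintype α] [DecidableEq α]

/-- The probability that the random subset of `α` containing each `e` independently with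
probability `p e` equals `S`. -/
noncomputable def bernoulliWeight (p : α → ℝ) (S : Finset α) : ℝ :=
  ∏ e, if e ∈ S then p e else 1 - p e

/-- The expectation of `f S` where the random subset `S` of `α` contains each `e` independently
with probability `p e`. -/
noncomputable def bernoulliMean (p : α → ℝ) (f : Finset α → ℝ) : ℝ :=
  ∑ S, bernoulliWeight p S * f S

/-- The indicator of the event that a random subset contains `T`. -/
def containsInd (T S : Finset α) : ℝ := if T ⊆ S then 1 else 0

variable {p : α → ℝ}

lemma bernoulliWeight_nonneg (hp : ∀ e, 0 ≤ p e ∧ p e ≤ 1) (S : Finset α) :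
    0 ≤ bernoulliWeight p S :=
  Finset.prod_nonneg fun e _ => by
    split_ifs
    · exact (hp e).1
    · linarith [(hp e).2]

lemma bernoulliWeight_eq (p : α → ℝ) (S : Finset α) :
    bernoulliWeight p S = (∏ e ∈ S, p e) * ∏ e ∈ Sᶜ, (1 - p e) := by
  rw [bernoulliWeight, Finset.prod_ite]
  congr 2 <;> ext <;> simp

lemma sum_bernoulliWeight (p : α → ℝ) : ∑ S, bernoulliWeight p S = 1 := by
  have h := Finset.prod_add p (fun e => 1 - p e) Finset.univ
  simp only [add_sub_cancel, Finset.prod_const_one, Finset.powerset_univ] at h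
  rw [h]
  exact Finset.sum_congr rfl fun S _ => by rw [bernoulliWeight_eq, Finset.compl_eq_univ_sdiff]

lemma bernoulliMean_add (f g : Finset α → ℝ) :
    bernoulliMean p (fun S => f S + g S) = bernoulliMean p f + bernoulliMean p g := by
  simp [bernoulliMean, mul_add, Finset.sum_add_distrib]

lemma bernoulliMean_sub (f g : Finset α → ℝ) :
    bernoulliMean p (fun S => f S - g S) = bernoulliMean p f - bernoulliMean p g := by
  simp [bernoulliMean, mul_sub, Finset.sum_sub_distrib]

lemma bernoulliMean_const_mul (c : ℝ) (f : Finset α → ℝ) :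
    bernoulliMean p (fun S => c * f S) = c * bernoulliMean p f := by
  simp only [bernoulliMean, Finset.mul_sum]
  exact Finset.sum_congr rfl fun S _ => by ring

lemma bernoulliMean_neg (f : Finset α → ℝ) :
    bernoulliMean p (fun S => -f S) = -bernoulliMean p f := by
  simp [bernoulliMean]

lemma bernoulliMean_const (c : ℝ) : bernoulliMean p (fun _ => c) = c := by
  simp [bernoulliMean, ← Finset.sum_mul, sum_bernoulliWeight]

lemma bernoulliMean_sum {ι : Type*} (s : Finset ι) (f : ι → Finset α → ℝ) :
    bernoulliMean p (fun S => ∑ i ∈ s, f i S) = ∑ i ∈ s, bernoulliMean p (f i) := by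
  simp only [bernoulliMean, Finset.mul_sum]
  exact Finset.sum_comm

lemma bernoulliMean_mono (hp : ∀ e, 0 ≤ p e ∧ p e ≤ 1) {f g : Finset α → ℝ}
    (h : ∀ S, f S ≤ g S) : bernoulliMean p f ≤ bernoulliMean p g :=
  Finset.sum_le_sum fun S _ => mul_le_mul_of_nonneg_left (h S) (bernoulliWeight_nonneg hp S)

lemma bernoulliMean_nonneg (hp : ∀ e, 0 ≤ p e ∧ p e ≤ 1) {f : Finset α → ℝ}
    (h : ∀ S, 0 ≤ f S) : 0 ≤ bernoulliMean p f :=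
  Finset.sum_nonneg fun S _ => mul_nonneg (bernoulliWeight_nonneg hp S) (h S)

/-- The FKG lattice condition, with equality because the measure is a product. -/
lemma bernoulliWeight_mul (p : α → ℝ) (A B : Finset α) :
    bernoulliWeight p A * bernoulliWeight p B =
      bernoulliWeight p (A ⊓ B) * bernoulliWeight p (A ⊔ B) := by
  simp only [bernoulliWeight, ← Finset.prod_mul_distrib, Finset.inf_eq_inter, Finset.sup_eq_union,
    Finset.mem_inter, Finset.mem_union]
  refine Finset.prod_congr rfl fun e _ => ?_
  by_cases ha : e ∈ A <;> by_cases hb : e ∈ B <;> simp [ha, hb, mul_comm]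

/-- **Harris' inequality** for two increasing functions. -/
lemma bernoulliMean_mul_le_of_monotone (hp : ∀ e, 0 ≤ p e ∧ p e ≤ 1) {f g : Finset α → ℝ}
    (hf : Monotone f) (hg : Monotone g) :
    bernoulliMean p f * bernoulliMean p g ≤ bernoulliMean p (fun S => f S * g S) := by
  -- `fkg` asks for nonnegative functions; subtracting the minimal value, attained at `∅`, leaves
  -- the covariance unchanged.
  have h := fkg (μ := bernoulliWeight p) (f := fun S => f S - f ∅) (g := fun S => g S - g ∅)
    (fun S => bernoulliWeight_nonneg hp S) (fun S => sub_nonneg.2 (hf (Finset.empty_subset S)))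
    (fun S => sub_nonneg.2 (hg (Finset.empty_subset S)))
    (fun S T h => sub_le_sub_right (hf h) _) (fun S T h => sub_le_sub_right (hg h) _)
    (fun A B => (bernoulliWeight_mul p A B).le)
  rw [sum_bernoulliWeight, one_mul] at h
  change bernoulliMean p _ * bernoulliMean p _ ≤ bernoulliMean p _ at h
  have e : (fun S => (f S - f ∅) * (g S - g ∅)) =
      fun S => f S * g S - (f ∅ * g S + (g ∅ * f S - f ∅ * g ∅)) := by
    ext S; ring
  rw [e, bernoulliMean_sub, bernoulliMean_sub, bernoulliMean_sub, bernoulliMean_add,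
    bernoulliMean_sub, bernoulliMean_const_mul, bernoulliMean_const_mul, bernoulliMean_const,
    bernoulliMean_const, bernoulliMean_const] at h
  linarith

/-- **Harris' inequality** for two decreasing functions. -/
lemma bernoulliMean_mul_le_of_antitone (hp : ∀ e, 0 ≤ p e ∧ p e ≤ 1) {f g : Finset α → ℝ}
    (hf : Antitone f) (hg : Antitone g) :
    bernoulliMean p f * bernoulliMean p g ≤ bernoulliMean p (fun S => f S * g S) := by
  have h := bernoulliMean_mul_le_of_monotone hp hf.neg hg.neg
  simpa [bernoulliMean_neg, Pi.neg_def] using h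

/-- **Harris' inequality** for an increasing and a decreasing function. -/
lemma bernoulliMean_mul_le_of_monotone_antitone (hp : ∀ e, 0 ≤ p e ∧ p e ≤ 1)
    {f g : Finset α → ℝ} (hf : Monotone f) (hg : Antitone g) :
    bernoulliMean p (fun S => f S * g S) ≤ bernoulliMean p f * bernoulliMean p g := by
  have h := bernoulliMean_mul_le_of_monotone hp hf hg.neg
  simpa [bernoulliMean_neg, Pi.neg_def] using h

lemma containsInd_nonneg (T S : Finset α) : 0 ≤ containsInd T S := by
  unfold containsInd; split_ifs <;> norm_num

lemma containsInd_le_one (T S : Finset α) : containsInd T S ≤ 1 := by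
  unfold containsInd; split_ifs <;> norm_num

lemma containsInd_monotone (T : Finset α) : Monotone (containsInd T) := fun A B h => by
  unfold containsInd
  by_cases hA : T ⊆ A
  · rw [if_pos hA, if_pos (hA.trans h)]
  · rw [if_neg hA]; split_ifs <;> norm_num

lemma containsInd_mul (T U S : Finset α) :
    containsInd T S * containsInd U S = containsInd (T ∪ U) S := by
  simp only [containsInd, Finset.union_subset_iff, ite_and]
  split_ifs <;> simp

/-- The hypothesis says that `F` ignores `e`. Pairing each `t` not containing `e` with `insert e t`
splits off the factor for `e`. -/
lemma bernoulliMean_mem_mul (e : α) (F : Finset α → ℝ)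
    (hF : ∀ S, F (insert e S) = F (S.erase e)) :
    bernoulliMean p (fun S => (if e ∈ S then 1 else 0) * F S) = p e * bernoulliMean p F := by
  have hu : (Finset.univ : Finset (Finset α)) = (insert e (Finset.univ.erase e)).powerset := by
    rw [Finset.insert_erase (Finset.mem_univ e), Finset.powerset_univ]
  have hw1 : ∀ t ∈ (Finset.univ.erase e).powerset, bernoulliWeight p t =
      (1 - p e) * ∏ x ∈ Finset.univ.erase e, if x ∈ t then p x else 1 - p x := by
    intro t ht
    have : e ∉ t := fun h => by simpa using Finset.mem_powerset.1 ht h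
    rw [bernoulliWeight, ← Finset.mul_prod_erase _ _ (Finset.mem_univ e), if_neg this]
  have hw2 : ∀ t : Finset α, bernoulliWeight p (insert e t) =
      p e * ∏ x ∈ Finset.univ.erase e, if x ∈ t then p x else 1 - p x := by
    intro t
    rw [bernoulliWeight, ← Finset.mul_prod_erase _ _ (Finset.mem_univ e),
      if_pos (Finset.mem_insert_self e t)]
    congr 1
    refine Finset.prod_congr rfl fun x hx => ?_
    simp [Finset.mem_insert, (Finset.mem_erase.1 hx).1]
  have hne : e ∉ Finset.univ.erase e := by simp
  simp only [bernoulliMean]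
  rw [hu, Finset.sum_powerset_insert hne, Finset.sum_powerset_insert hne, ← Finset.sum_add_distrib,
    ← Finset.sum_add_distrib, Finset.mul_sum]
  refine Finset.sum_congr rfl fun t ht => ?_
  have het : e ∉ t := fun h => by simpa using Finset.mem_powerset.1 ht h
  rw [hw1 t ht, hw2, hF t, Finset.erase_eq_of_notMem het, if_neg het,
    if_pos (Finset.mem_insert_self e t)]
  ring

/-- The event of containing `T` is independent of every function that ignores `T`. -/
lemma bernoulliMean_containsInd_mul (T : Finset α) (F : Finset α → ℝ)
    (hF : ∀ e ∈ T, ∀ S, F (insert e S) = F (S.erase e)) :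
    bernoulliMean p (fun S => containsInd T S * F S) = (∏ e ∈ T, p e) * bernoulliMean p F := by
  induction T using Finset.induction_on with
  | empty => simp [containsInd]
  | insert e T he ih =>
    rw [Finset.prod_insert he, mul_assoc, ← ih fun x hx => hF x (Finset.mem_insert_of_mem hx),
      ← bernoulliMean_mem_mul]
    · congr 1
      ext S
      simp only [containsInd, Finset.insert_subset_iff, ite_and]
      split_ifs <;> simp
    · intro S
      rw [hF e (Finset.mem_insert_self e T)]
      simp only [containsInd, Finset.subset_insert_iff_of_notMem he, Finset.subset_erase, he,
        not_false_eq_true, and_true]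

lemma bernoulliMean_containsInd (T : Finset α) :
    bernoulliMean p (containsInd T) = ∏ e ∈ T, p e := by
  simpa [bernoulliMean_const] using bernoulliMean_containsInd_mul (p := p) T (fun _ => 1) (by simp)

variable {ι : Type*} [DecidableEq ι]

/-- The indicator of the event that a random subset contains none of the sets `B j`, `j ∈ J`. -/
def avoidsInd (B : ι → Finset α) (J : Finset ι) (S : Finset α) : ℝ :=
  ∏ j ∈ J, (1 - containsInd (B j) S)

lemma avoidsInd_empty (B : ι → Finset α) : avoidsInd B ∅ = fun _ => 1 := by
  ext S; simp [avoidsInd]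

lemma avoidsInd_nonneg (B : ι → Finset α) (J : Finset ι) (S : Finset α) : 0 ≤ avoidsInd B J S :=
  Finset.prod_nonneg fun _ _ => sub_nonneg.2 (containsInd_le_one _ _)

lemma avoidsInd_le_one (B : ι → Finset α) (J : Finset ι) (S : Finset α) : avoidsInd B J S ≤ 1 :=
  Finset.prod_le_one (fun _ _ => sub_nonneg.2 (containsInd_le_one _ _))
    fun _ _ => by linarith [containsInd_nonneg (B ‹_›) S]

lemma avoidsInd_antitone (B : ι → Finset α) (J : Finset ι) : Antitone (avoidsInd B J) :=
  fun _ _ h => Finset.prod_le_prod (fun _ _ => sub_nonneg.2 (containsInd_le_one _ _))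
    fun j _ => sub_le_sub_left (containsInd_monotone (B j) h) _

lemma avoidsInd_insert (B : ι → Finset α) {J : Finset ι} {i : ι} (hi : i ∉ J) (S : Finset α) :
    avoidsInd B (insert i J) S = avoidsInd B J S - containsInd (B i) S * avoidsInd B J S := by
  rw [avoidsInd, Finset.prod_insert hi, ← avoidsInd]; ring

lemma one_sub_sum_le_avoidsInd (B : ι → Finset α) (J : Finset ι) (S : Finset α) :
    1 - ∑ j ∈ J, containsInd (B j) S ≤ avoidsInd B J S := by
  induction J using Finset.induction_on with
  | empty => simp [avoidsInd]
  | insert i J hi ih =>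
    rw [avoidsInd_insert B hi, Finset.sum_insert hi]
    nlinarith [avoidsInd_le_one B J S, containsInd_nonneg (B i) S]

/-- Lower bound for the probability of avoiding all sets of a family. -/
lemma prod_one_sub_le_bernoulliMean_avoidsInd (hp : ∀ e, 0 ≤ p e ∧ p e ≤ 1)
    (B : ι → Finset α) (J : Finset ι) :
    ∏ j ∈ J, (1 - ∏ e ∈ B j, p e) ≤ bernoulliMean p (avoidsInd B J) := by
  induction J using Finset.induction_on with
  | empty => simp [avoidsInd_empty, bernoulliMean_const]
  | insert i J hi ih =>
    have h1 : 0 ≤ 1 - ∏ e ∈ B i, p e :=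
      sub_nonneg.2 (Finset.prod_le_one (fun e _ => (hp e).1) fun e _ => (hp e).2)
    have h2 := bernoulliMean_mul_le_of_antitone hp
      (f := fun S => 1 - containsInd (B i) S) (g := avoidsInd B J)
      (fun S S' h => sub_le_sub_left (containsInd_monotone (B i) h) _) (avoidsInd_antitone B J)
    rw [bernoulliMean_sub, bernoulliMean_const, bernoulliMean_containsInd] at h2
    rw [Finset.prod_insert hi]
    refine (mul_le_mul_of_nonneg_left ih h1).trans (h2.trans_eq ?_)
    congr 1
    ext S
    simp [avoidsInd, Finset.prod_insert hi]

/-- **Janson's inequality**. -/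
lemma bernoulliMean_avoidsInd_le (hp : ∀ e, 0 ≤ p e ∧ p e ≤ 1)
    (B : ι → Finset α) (J : Finset ι) :
    bernoulliMean p (avoidsInd B J) ≤ Real.exp (-(∑ i ∈ J, ∏ e ∈ B i, p e) +
      ∑ i ∈ J, ∑ j ∈ J with j ≠ i ∧ ¬Disjoint (B i) (B j), ∏ e ∈ B i ∪ B j, p e) := by
  have hpr : ∀ T : Finset α, 0 ≤ ∏ e ∈ T, p e := fun T => Finset.prod_nonneg fun e _ => (hp e).1
  -- Sets are added one at a time, but each is charged its overlaps with all of `J`. The exponent is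
  -- then additive in `K`, at the price of counting ordered instead of unordered pairs.
  suffices H : ∀ K ⊆ J, bernoulliMean p (avoidsInd B K) ≤ Real.exp (∑ i ∈ K,
      (-(∏ e ∈ B i, p e) +
        ∑ j ∈ J with j ≠ i ∧ ¬Disjoint (B i) (B j), ∏ e ∈ B i ∪ B j, p e)) by
    have := H J subset_rfl
    rwa [Finset.sum_add_distrib, Finset.sum_neg_distrib] at this
  intro K
  induction K using Finset.induction_on with
  | empty => simp [avoidsInd_empty, bernoulliMean_const]
  | insert i K hi ih =>
    intro hK
    have hKJ : K ⊆ J := (Finset.subset_insert i K).trans hK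
    set P := ∏ e ∈ B i, p e with hP
    set Δ := ∑ j ∈ J with j ≠ i ∧ ¬Disjoint (B i) (B j), ∏ e ∈ B i ∪ B j, p e with hΔ
    set K1 := K.filter fun j => ¬Disjoint (B i) (B j) with hK1
    set K2 := K.filter fun j => Disjoint (B i) (B j) with hK2
    have hsplit : ∀ S, avoidsInd B K S = avoidsInd B K1 S * avoidsInd B K2 S := fun S => by
      rw [mul_comm]
      exact (Finset.prod_filter_mul_prod_filter_not K (fun j => Disjoint (B i) (B j)) _).symm
    have hm := bernoulliMean_nonneg hp (avoidsInd_nonneg B K)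
    have hm2 := bernoulliMean_nonneg hp (avoidsInd_nonneg B K2)
    have hle : bernoulliMean p (avoidsInd B K) ≤ bernoulliMean p (avoidsInd B K2) :=
      bernoulliMean_mono hp fun S => by
        rw [hsplit]
        exact mul_le_of_le_one_left (avoidsInd_nonneg _ _ _) (avoidsInd_le_one _ _ _)
    have hind : bernoulliMean p (fun S => containsInd (B i) S * avoidsInd B K2 S) =
        P * bernoulliMean p (avoidsInd B K2) := by
      refine bernoulliMean_containsInd_mul _ _ fun e he S => ?_
      refine Finset.prod_congr rfl fun j hj => ?_
      have hej : e ∉ B j := Finset.disjoint_left.1 (Finset.mem_filter.1 hj).2 he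
      simp only [containsInd, Finset.subset_insert_iff_of_notMem hej, Finset.subset_erase, hej,
        not_false_eq_true, and_true]
    have hsum : ∑ j ∈ K1, bernoulliMean p
        (fun S => containsInd (B i ∪ B j) S * avoidsInd B K2 S) ≤
        Δ * bernoulliMean p (avoidsInd B K2) := by
      calc _ ≤ ∑ j ∈ K1, (∏ e ∈ B i ∪ B j, p e) * bernoulliMean p (avoidsInd B K2) := by
            refine Finset.sum_le_sum fun j _ => ?_
            rw [← bernoulliMean_containsInd (p := p)]
            exact bernoulliMean_mul_le_of_monotone_antitone hp (containsInd_monotone _)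
              (avoidsInd_antitone _ _)
        _ ≤ _ := by
            rw [← Finset.sum_mul]
            refine mul_le_mul_of_nonneg_right ?_ hm2
            refine Finset.sum_le_sum_of_subset_of_nonneg (fun j hj => ?_) fun _ _ _ => hpr _
            have := Finset.mem_filter.1 hj
            exact Finset.mem_filter.2 ⟨hKJ this.1, fun h => hi (h ▸ this.1), this.2⟩
    -- Given that `B i` is present, the family `K2` is unaffected; a union bound handles `K1`, and
    -- Harris decouples each `B i ∪ B j` from avoiding `K2`.
    have hlow : (P - Δ) * bernoulliMean p (avoidsInd B K2) ≤
        bernoulliMean p (fun S => containsInd (B i) S * avoidsInd B K S) := by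
      calc _ ≤ bernoulliMean p (fun S => containsInd (B i) S * avoidsInd B K2 S -
              ∑ j ∈ K1, containsInd (B i ∪ B j) S * avoidsInd B K2 S) := by
            rw [bernoulliMean_sub, bernoulliMean_sum, hind, sub_mul]
            linarith
        _ ≤ _ := by
            refine bernoulliMean_mono hp fun S => ?_
            rw [hsplit]
            have := mul_le_mul_of_nonneg_left (one_sub_sum_le_avoidsInd B K1 S)
              (mul_nonneg (containsInd_nonneg (B i) S) (avoidsInd_nonneg B K2 S))
            simp only [← containsInd_mul]
            rw [mul_sub, Finset.mul_sum] at this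
            calc _ = _ := ?_
              _ ≤ _ := this
              _ = _ := by ring
            rw [mul_one]
            congr 1
            exact Finset.sum_congr rfl fun j _ => by ring
    rw [Finset.sum_insert hi, Real.exp_add, mul_comm]
    have hexp : 1 - (P - Δ) ≤ Real.exp (-P + Δ) := by
      have := Real.add_one_le_exp (-P + Δ); linarith
    have hins : bernoulliMean p (avoidsInd B (insert i K)) = bernoulliMean p (avoidsInd B K) -
        bernoulliMean p (fun S => containsInd (B i) S * avoidsInd B K S) := by
      rw [← bernoulliMean_sub]
      congr 1
      ext S
      exact avoidsInd_insert B hi S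
    have hpos : 0 ≤ bernoulliMean p (fun S => containsInd (B i) S * avoidsInd B K S) :=
      bernoulliMean_nonneg hp fun S => mul_nonneg (containsInd_nonneg _ _) (avoidsInd_nonneg _ _ _)
    have hstep : bernoulliMean p (avoidsInd B (insert i K)) ≤
        bernoulliMean p (avoidsInd B K) * (1 - (P - Δ)) := by
      rw [hins]
      -- If `P - Δ` is nonnegative, use `hlow` and `hle`; otherwise the factor exceeds one and
      -- `hpos` suffices.
      rcases le_total 0 (P - Δ) with h | h
      · nlinarith
      · nlinarith
    exact hstep.trans ((mul_le_mul_of_nonneg_left hexp hm).trans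
      (mul_le_mul_of_nonneg_right (ih hKJ) (Real.exp_pos _).le))

end BernoulliSubsets

/-! ### Poisson approximation for positively correlated indicators. -/

section PoissonApproximation

variable {α : Type*} [Fintype α] [DecidableEq α] {p : α → ℝ}

/-- Positive association bounds the covariance of a decreasing function with a Lipschitz function of
a decreasing function. -/
lemma abs_bernoulliMean_mul_sub_le (hp : ∀ e, 0 ≤ p e ∧ p e ≤ 1) {A V : Finset α → ℝ}
    (hA : Antitone A) (hV : Antitone V) {h : ℝ → ℝ} {K : ℝ}
    (hh : ∀ x y, |h x - h y| ≤ K * |x - y|) :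
    |bernoulliMean p (fun S => A S * h (V S)) -
      bernoulliMean p A * bernoulliMean p (fun S => h (V S))| ≤
    K * (bernoulliMean p (fun S => A S * V S) - bernoulliMean p A * bernoulliMean p V) := by
  have key : ∀ g : ℝ → ℝ, (∀ x y, |g x - g y| ≤ K * |x - y|) →
      -(K * (bernoulliMean p (fun S => A S * V S) - bernoulliMean p A * bernoulliMean p V)) ≤
      bernoulliMean p (fun S => A S * g (V S)) -
        bernoulliMean p A * bernoulliMean p (fun S => g (V S)) := by
    intro g hg
    -- Adding `K * x` makes a `K`-Lipschitz function nondecreasing, so Harris applies. Using both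
    -- `h` and `-h` gives the two-sided bound.
    have hanti : Antitone fun S => K * V S + g (V S) := by
      intro S T hST
      have h1 := hg (V T) (V S)
      rw [abs_of_nonpos (sub_nonpos.2 (hV hST))] at h1
      have := (abs_le.1 h1).2
      change K * V T + g (V T) ≤ K * V S + g (V S)
      linarith
    have h2 := bernoulliMean_mul_le_of_antitone hp hA hanti
    have e : (fun S => A S * (K * V S + g (V S))) =
        fun S => K * (A S * V S) + A S * g (V S) := by ext S; ring
    rw [e, bernoulliMean_add, bernoulliMean_add, bernoulliMean_const_mul,
      bernoulliMean_const_mul] at h2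
    linarith
  have h1 := key h hh
  have h2 := key (fun x => -h x) fun x y => by
    rw [show -h x - -h y = -(h x - h y) by ring, abs_neg]; exact hh x y
  simp only [mul_neg, bernoulliMean_neg] at h2
  rw [abs_le]
  constructor <;> linarith

/-- The complex-valued expectation of a function of a Bernoulli random subset. -/
noncomputable def bernoulliMeanC (p : α → ℝ) (f : Finset α → ℂ) : ℂ :=
  ∑ S, (bernoulliWeight p S : ℂ) * f S

lemma bernoulliMeanC_sub (f g : Finset α → ℂ) :
    bernoulliMeanC p (fun S => f S - g S) = bernoulliMeanC p f - bernoulliMeanC p g := by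
  simp [bernoulliMeanC, mul_sub, Finset.sum_sub_distrib]

lemma bernoulliMeanC_const_mul (c : ℂ) (f : Finset α → ℂ) :
    bernoulliMeanC p (fun S => c * f S) = c * bernoulliMeanC p f := by
  simp only [bernoulliMeanC, Finset.mul_sum]
  exact Finset.sum_congr rfl fun S _ => by ring

lemma bernoulliMeanC_sum {ι : Type*} (s : Finset ι) (f : ι → Finset α → ℂ) :
    bernoulliMeanC p (fun S => ∑ i ∈ s, f i S) = ∑ i ∈ s, bernoulliMeanC p (f i) := by
  simp only [bernoulliMeanC, Finset.mul_sum]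
  exact Finset.sum_comm

lemma bernoulliMeanC_re (f : Finset α → ℂ) :
    (bernoulliMeanC p f).re = bernoulliMean p fun S => (f S).re := by
  simp [bernoulliMeanC, bernoulliMean]

lemma bernoulliMeanC_im (f : Finset α → ℂ) :
    (bernoulliMeanC p f).im = bernoulliMean p fun S => (f S).im := by
  simp [bernoulliMeanC, bernoulliMean]

lemma norm_bernoulliMeanC_le (hp : ∀ e, 0 ≤ p e ∧ p e ≤ 1) (f : Finset α → ℂ) :
    ‖bernoulliMeanC p f‖ ≤ bernoulliMean p fun S => ‖f S‖ := by
  refine (norm_sum_le _ _).trans (Finset.sum_le_sum fun S _ => ?_)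
  rw [norm_mul, Complex.norm_real, Real.norm_of_nonneg (bernoulliWeight_nonneg hp S)]

lemma abs_cos_mul_sub_cos_mul_le (t x y : ℝ) :
    |Real.cos (t * x) - Real.cos (t * y)| ≤ |t| * |x - y| := by
  rw [← abs_mul, mul_sub]
  simpa [Real.dist_eq] using Real.lipschitzWith_cos.dist_le_mul (t * x) (t * y)

lemma abs_sin_mul_sub_sin_mul_le (t x y : ℝ) :
    |Real.sin (t * x) - Real.sin (t * y)| ≤ |t| * |x - y| := by
  rw [← abs_mul, mul_sub]
  simpa [Real.dist_eq] using Real.lipschitzWith_sin.dist_le_mul (t * x) (t * y)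

lemma norm_exp_mul_I_sub_le (t x y : ℝ) :
    ‖Complex.exp ((t * x : ℝ) * Complex.I) - Complex.exp ((t * y : ℝ) * Complex.I)‖ ≤
      2 * |t| * |x - y| := by
  refine (Complex.norm_le_abs_re_add_abs_im _).trans ?_
  rw [Complex.sub_re, Complex.sub_im, Complex.exp_ofReal_mul_I_re, Complex.exp_ofReal_mul_I_re,
    Complex.exp_ofReal_mul_I_im, Complex.exp_ofReal_mul_I_im]
  linarith [abs_cos_mul_sub_cos_mul_le t x y, abs_sin_mul_sub_sin_mul_le t x y]

lemma norm_bernoulliMeanC_mul_exp_sub_le (hp : ∀ e, 0 ≤ p e ∧ p e ≤ 1) {A V : Finset α → ℝ}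
    (hA : Antitone A) (hV : Antitone V) (t : ℝ) :
    ‖bernoulliMeanC p (fun S => (A S : ℂ) * Complex.exp ((t * V S : ℝ) * Complex.I)) -
      (bernoulliMean p A : ℂ) * bernoulliMeanC p fun S => Complex.exp ((t * V S : ℝ) * Complex.I)‖ ≤
    2 * |t| * (bernoulliMean p (fun S => A S * V S) - bernoulliMean p A * bernoulliMean p V) := by
  refine (Complex.norm_le_abs_re_add_abs_im _).trans ?_
  simp only [Complex.sub_re, Complex.sub_im, Complex.re_ofReal_mul, Complex.im_ofReal_mul,
    bernoulliMeanC_re, bernoulliMeanC_im, Complex.exp_ofReal_mul_I_re, Complex.exp_ofReal_mul_I_im]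
  have h1 := abs_bernoulliMean_mul_sub_le hp hA hV (abs_cos_mul_sub_cos_mul_le t)
  have h2 := abs_bernoulliMean_mul_sub_le hp hA hV (abs_sin_mul_sub_sin_mul_le t)
  linarith

variable {ι : Type*} [DecidableEq ι]

/-- The quantity that controls the distance to the Poisson distribution of a sum of positively
related indicators. -/
noncomputable def dependence (p : α → ℝ) (X : ι → Finset α → ℝ) (s : Finset ι) : ℝ :=
  ∑ i ∈ s, (bernoulliMean p (X i) ^ 2 + ∑ j ∈ s.erase i,
    (bernoulliMean p (fun S => X i S * X j S) - bernoulliMean p (X i) * bernoulliMean p (X j)))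

/-- The approximate Stein equation for the characteristic function. -/
lemma norm_bernoulliMeanC_stein_le (hp : ∀ e, 0 ≤ p e ∧ p e ≤ 1) {X : ι → Finset α → ℝ}
    (hX : ∀ i S, X i S = 0 ∨ X i S = 1) (hanti : ∀ i, Antitone (X i)) (s : Finset ι) (t : ℝ) :
    ‖bernoulliMeanC p (fun S => ((∑ i ∈ s, X i S : ℝ) : ℂ) *
        Complex.exp ((t * ∑ i ∈ s, X i S : ℝ) * Complex.I)) -
      (∑ i ∈ s, bernoulliMean p (X i) : ℝ) * Complex.exp (t * Complex.I) *
        bernoulliMeanC p (fun S => Complex.exp ((t * ∑ i ∈ s, X i S : ℝ) * Complex.I))‖ ≤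
    2 * |t| * dependence p X s := by
  have hnn : ∀ i S, 0 ≤ X i S := fun i S => by rcases hX i S with h | h <;> simp [h]
  have hW : ∀ S, ∀ i ∈ s, ∑ j ∈ s, X j S = X i S + ∑ j ∈ s.erase i, X j S := fun S i hi =>
    (Finset.add_sum_erase s (fun j => X j S) hi).symm
  set φ := bernoulliMeanC p (fun S => Complex.exp ((t * ∑ i ∈ s, X i S : ℝ) * Complex.I)) with hφ
  have e1 : bernoulliMeanC p (fun S => ((∑ i ∈ s, X i S : ℝ) : ℂ) *
        Complex.exp ((t * ∑ i ∈ s, X i S : ℝ) * Complex.I)) =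
      ∑ i ∈ s, Complex.exp (t * Complex.I) * bernoulliMeanC p (fun S => (X i S : ℂ) *
        Complex.exp ((t * ∑ j ∈ s.erase i, X j S : ℝ) * Complex.I)) := by
    simp only [← bernoulliMeanC_const_mul]
    rw [← bernoulliMeanC_sum]
    congr 1
    ext S
    rw [Complex.ofReal_sum, Finset.sum_mul]
    refine Finset.sum_congr rfl fun i hi => ?_
    -- As `X i` is 0 or 1, where it does not vanish its own contribution to the exponential is
    -- exactly `exp (it)`.
    rcases hX i S with h | h
    · simp [h]
    · rw [hW S i hi, h]
      simp only [Complex.ofReal_one, one_mul]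
      rw [← Complex.exp_add]
      congr 1
      push_cast
      ring
  rw [e1, Complex.ofReal_sum, Finset.sum_mul, Finset.sum_mul, ← Finset.sum_sub_distrib]
  refine (norm_sum_le _ _).trans ?_
  rw [dependence, Finset.mul_sum]
  refine Finset.sum_le_sum fun i hi => ?_
  have hVanti : Antitone fun S => ∑ j ∈ s.erase i, X j S := fun S T h =>
    Finset.sum_le_sum fun j _ => hanti j h
  have h1 := norm_bernoulliMeanC_mul_exp_sub_le hp (hanti i) hVanti t
  set ψ := bernoulliMeanC p (fun S => Complex.exp ((t * ∑ j ∈ s.erase i, X j S : ℝ) * Complex.I))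
    with hψ
  -- Putting `X i` back into the sum; after multiplication by the mean of `X i` this is the squared
  -- term of `dependence`.
  have h2 : ‖ψ - φ‖ ≤ 2 * |t| * bernoulliMean p (X i) := by
    rw [hψ, hφ, ← bernoulliMeanC_sub, ← bernoulliMean_const_mul]
    refine (norm_bernoulliMeanC_le hp _).trans (bernoulliMean_mono hp fun S => ?_)
    refine (norm_exp_mul_I_sub_le _ _ _).trans ?_
    rw [hW S i hi, show ∑ j ∈ s.erase i, X j S - (X i S + ∑ j ∈ s.erase i, X j S) = -X i S by ring,
      abs_neg, abs_of_nonneg (hnn i S)]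
  have hcov : bernoulliMean p (fun S => X i S * ∑ j ∈ s.erase i, X j S) -
      bernoulliMean p (X i) * bernoulliMean p (fun S => ∑ j ∈ s.erase i, X j S) =
      ∑ j ∈ s.erase i, (bernoulliMean p (fun S => X i S * X j S) -
        bernoulliMean p (X i) * bernoulliMean p (X j)) := by
    simp only [Finset.mul_sum, bernoulliMean_sum, Finset.sum_sub_distrib]
  rw [hcov] at h1
  have hpi : 0 ≤ bernoulliMean p (X i) := bernoulliMean_nonneg hp (hnn i)
  set P := bernoulliMean p (X i) with hP
  set Q := bernoulliMeanC p (fun S => (X i S : ℂ) *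
        Complex.exp ((t * ∑ j ∈ s.erase i, X j S : ℝ) * Complex.I)) with hQ
  calc ‖Complex.exp (t * Complex.I) * Q - (P : ℂ) * Complex.exp (t * Complex.I) * φ‖
      = ‖Complex.exp (t * Complex.I) * ((Q - P * ψ) + P * (ψ - φ))‖ := by congr 1; ring
    _ = ‖(Q - P * ψ) + P * (ψ - φ)‖ := by rw [norm_mul, Complex.norm_exp_ofReal_mul_I, one_mul]
    _ ≤ ‖Q - P * ψ‖ + P * ‖ψ - φ‖ := by
        refine (norm_add_le _ _).trans_eq ?_
        rw [norm_mul, Complex.norm_real, Real.norm_of_nonneg hpi]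
    _ ≤ _ := by nlinarith [mul_le_mul_of_nonneg_left h2 hpi]

/-- Poisson approximation for the number of occurring events among decreasing events of a Bernoulli
random subset. -/
theorem norm_bernoulliMeanC_sub_poisson_le (hp : ∀ e, 0 ≤ p e ∧ p e ≤ 1) {X : ι → Finset α → ℝ}
    (hX : ∀ i S, X i S = 0 ∨ X i S = 1) (hanti : ∀ i, Antitone (X i)) (s : Finset ι) (t : ℝ) :
    ‖bernoulliMeanC p (fun S => Complex.exp ((t * ∑ i ∈ s, X i S : ℝ) * Complex.I)) -
      Complex.exp ((∑ i ∈ s, bernoulliMean p (X i) : ℝ) * (Complex.exp (t * Complex.I) - 1))‖ ≤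
    2 * t ^ 2 * dependence p X s * Real.exp (2 * ∑ i ∈ s, bernoulliMean p (X i)) := by
  have hnn : ∀ i S, 0 ≤ X i S := fun i S => by rcases hX i S with h | h <;> simp [h]
  set l : ℝ := ∑ i ∈ s, bernoulliMean p (X i) with hl
  have hl0 : 0 ≤ l := Finset.sum_nonneg fun i _ => bernoulliMean_nonneg hp (hnn i)
  set D := dependence p X s
  set W : Finset α → ℝ := fun S => ∑ i ∈ s, X i S with hW
  set φ : ℝ → ℂ := fun u => bernoulliMeanC p (fun S => Complex.exp ((u * W S : ℝ) * Complex.I))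
    with hφ
  -- Dividing by the Poisson characteristic function: `ψ` would be constantly 1 if the Stein
  -- equation were exact, so its derivative is the Stein error times a factor of norm at most `exp
  -- (2 * l)`.
  set ψ : ℝ → ℂ := fun u => φ u * Complex.exp (-(l * (Complex.exp (u * Complex.I) - 1))) with hψ
  have hφ' : ∀ u, HasDerivAt φ (Complex.I * bernoulliMeanC p (fun S => ((W S : ℝ) : ℂ) *
      Complex.exp ((u * W S : ℝ) * Complex.I))) u := by
    intro u
    have : HasDerivAt φ (∑ S, (bernoulliWeight p S : ℂ) *
        (Complex.exp ((u * W S : ℝ) * Complex.I) * ((W S : ℂ) * Complex.I))) u := by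
      refine HasDerivAt.fun_sum fun S _ => HasDerivAt.const_mul _ (HasDerivAt.cexp ?_)
      have h := (((hasDerivAt_id u).mul_const (W S)).ofReal_comp).mul_const Complex.I
      simpa using h
    convert this using 1
    rw [bernoulliMeanC, Finset.mul_sum]
    exact Finset.sum_congr rfl fun S _ => by ring
  have hE' : ∀ u : ℝ, HasDerivAt (fun u : ℝ => Complex.exp (u * Complex.I))
      (Complex.exp (u * Complex.I) * Complex.I) u := by
    intro u
    refine HasDerivAt.cexp ?_
    simpa using (hasDerivAt_id u).ofReal_comp.mul_const Complex.I
  have hψ' : ∀ u, HasDerivAt ψ (Complex.I * (bernoulliMeanC p (fun S => ((W S : ℝ) : ℂ) *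
      Complex.exp ((u * W S : ℝ) * Complex.I)) - (l : ℂ) * Complex.exp (u * Complex.I) * φ u) *
      Complex.exp (-(l * (Complex.exp (u * Complex.I) - 1)))) u := by
    intro u
    have h2 : HasDerivAt (fun u : ℝ => Complex.exp (-(l * (Complex.exp (u * Complex.I) - 1))))
        (Complex.exp (-(l * (Complex.exp (u * Complex.I) - 1))) *
          -(l * (Complex.exp (u * Complex.I) * Complex.I))) u :=
      (((hE' u).sub_const 1).const_mul (l : ℂ)).neg.cexp
    refine ((hφ' u).mul h2).congr_deriv ?_
    ring
  have hre : ∀ u : ℝ, ((l : ℂ) * (Complex.exp (u * Complex.I) - 1)).re =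
      l * (Real.cos u - 1) := fun u => by
    rw [Complex.re_ofReal_mul, Complex.sub_re, Complex.exp_ofReal_mul_I_re, Complex.one_re]
  have hbound : ∀ u : ℝ, |u| ≤ |t| → ‖Complex.I * (bernoulliMeanC p (fun S => ((W S : ℝ) : ℂ) *
      Complex.exp ((u * W S : ℝ) * Complex.I)) - (l : ℂ) * Complex.exp (u * Complex.I) * φ u) *
      Complex.exp (-(l * (Complex.exp (u * Complex.I) - 1)))‖ ≤
      2 * |t| * D * Real.exp (2 * l) := by
    intro u hu
    rw [norm_mul, norm_mul, Complex.norm_I, one_mul, Complex.norm_exp, Complex.neg_re, hre]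
    have h1 := norm_bernoulliMeanC_stein_le hp hX hanti s u
    have hD : 0 ≤ D := by
      refine Finset.sum_nonneg fun i _ => add_nonneg (sq_nonneg _) (Finset.sum_nonneg fun j _ => ?_)
      exact sub_nonneg.2 (bernoulliMean_mul_le_of_antitone hp (hanti i) (hanti j))
    refine mul_le_mul (h1.trans ?_) (Real.exp_le_exp.2 ?_) (Real.exp_pos _).le (by positivity)
    · gcongr
    · nlinarith [Real.neg_one_le_cos u]
  have hmv := (convex_closedBall (0 : ℝ) |t|).norm_image_sub_le_of_norm_hasDerivWithin_le
    (f := ψ) (fun u _ => (hψ' u).hasDerivWithinAt) (fun u hu => hbound u (by simpa using hu))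
    (x := 0) (y := t) (by simp) (by simp)
  have hψ0 : ψ 0 = 1 := by
    simp only [hψ, hφ, bernoulliMeanC, zero_mul, Complex.ofReal_zero, Complex.exp_zero, mul_one,
      sub_self, mul_zero, neg_zero]
    exact_mod_cast sum_bernoulliWeight p
  rw [hψ0, sub_zero, Real.norm_eq_abs] at hmv
  have hfac : φ t - Complex.exp (l * (Complex.exp (t * Complex.I) - 1)) =
      (ψ t - 1) * Complex.exp (l * (Complex.exp (t * Complex.I) - 1)) := by
    simp only [hψ]
    rw [sub_mul, mul_assoc, ← Complex.exp_add, neg_add_cancel, Complex.exp_zero, mul_one, one_mul]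
  change ‖φ t - _‖ ≤ _
  rw [hfac, norm_mul, Complex.norm_exp, hre]
  have hle : Real.exp (l * (Real.cos t - 1)) ≤ 1 :=
    Real.exp_le_one_iff.2 (by nlinarith [Real.cos_le_one t])
  calc _ ≤ ‖ψ t - 1‖ * 1 := mul_le_mul_of_nonneg_left hle (norm_nonneg _)
    _ ≤ _ := by
      rw [mul_one]
      refine hmv.trans_eq ?_
      rw [← sq_abs t]; ring

end PoissonApproximation

/-! ### Counting paths and overlaps; bounds on the probability of remoteness. -/

section Paths

variable {V : Type*} [Fintype V] [LinearOrder V]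

/-- The edge probabilities of the binomial random graph, extended by zero to the diagonal. -/
noncomputable def edgeProb (V : Type*) [DecidableEq V] (r : ℝ) (e : Sym2 V) : ℝ :=
  if e.IsDiag then 0 else r

lemma edgeProb_mem {r : ℝ} (h0 : 0 ≤ r) (h1 : r ≤ 1) (e : Sym2 V) :
    0 ≤ edgeProb V r e ∧ edgeProb V r e ≤ 1 := by
  unfold edgeProb
  split_ifs
  · simp
  · exact ⟨h0, h1⟩

/-- The edges between consecutive vertices of a sequence. -/
def pathEdges {l : ℕ} (q : Fin (l + 1) → V) : Finset (Sym2 V) :=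
  Finset.univ.image fun k : Fin l => s(q k.castSucc, q k.succ)

lemma mem_range_of_mk_mem_pathEdges {l : ℕ} {q : Fin (l + 1) → V} {a b : V}
    (h : s(a, b) ∈ pathEdges q) : a ∈ Set.range q ∧ b ∈ Set.range q := by
  obtain ⟨k, -, hk⟩ := Finset.mem_image.1 h
  rcases Sym2.eq_iff.1 hk with ⟨h1, h2⟩ | ⟨h1, h2⟩
  · exact ⟨⟨_, h1⟩, ⟨_, h2⟩⟩
  · exact ⟨⟨_, h2⟩, ⟨_, h1⟩⟩

lemma pathEdge_injective {l : ℕ} {q : Fin (l + 1) → V} (hq : Function.Injective q) :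
    Function.Injective fun k : Fin l => s(q k.castSucc, q k.succ) := by
  intro j k h
  rcases Sym2.eq_iff.1 h with ⟨h1, -⟩ | ⟨h1, h2⟩
  · exact Fin.castSucc_injective _ (hq h1)
  · have h1 := congrArg Fin.val (hq h1)
    have h2 := congrArg Fin.val (hq h2)
    simp at h1 h2
    omega

lemma card_pathEdges {l : ℕ} {q : Fin (l + 1) → V} (hq : Function.Injective q) :
    (pathEdges q).card = l := by
  rw [pathEdges, Finset.card_image_of_injective _ (pathEdge_injective hq), Finset.card_univ,
    Fintype.card_fin]

lemma not_isDiag_of_mem_pathEdges {l : ℕ} {q : Fin (l + 1) → V} (hq : Function.Injective q)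
    {e : Sym2 V} (he : e ∈ pathEdges q) : ¬e.IsDiag := by
  obtain ⟨k, -, rfl⟩ := Finset.mem_image.1 he
  rw [Sym2.mk_isDiag_iff]
  exact fun h => (Fin.castSucc_lt_succ (i := k)).ne (hq h)

lemma prod_edgeProb {r : ℝ} {T : Finset (Sym2 V)} (hT : ∀ e ∈ T, ¬e.IsDiag) :
    ∏ e ∈ T, edgeProb V r e = r ^ T.card := by
  rw [Finset.prod_congr rfl fun e he => show edgeProb V r e = r from if_neg (hT e he), Finset.prod_const]

open Classical in
/-- The indicator that two vertices of the graph with edge set `S` are at distance more than `d`. -/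
noncomputable def remoteInd (d : ℕ) (x y : V) (S : Finset (Sym2 V)) : ℝ :=
  if (d : ℕ∞) < (SimpleGraph.fromEdgeSet (S : Set (Sym2 V))).edist x y then 1 else 0

lemma remoteInd_eq_zero_or_one (d : ℕ) (x y : V) (S : Finset (Sym2 V)) :
    remoteInd d x y S = 0 ∨ remoteInd d x y S = 1 := by
  unfold remoteInd; split_ifs <;> simp

lemma remoteInd_antitone (d : ℕ) (x y : V) : Antitone (remoteInd d x y) := by
  intro S T h
  have hle := SimpleGraph.edist_anti (u := x) (v := y)
    (SimpleGraph.fromEdgeSet_mono (Finset.coe_subset.2 h))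
  unfold remoteInd
  by_cases hT : (d : ℕ∞) < (SimpleGraph.fromEdgeSet (T : Set (Sym2 V))).edist x y
  · rw [if_pos hT, if_pos (hT.trans_le hle)]
  · rw [if_neg hT]; split_ifs <;> norm_num

lemma edist_le_of_pathEdges_subset {l : ℕ} {q : Fin (l + 1) → V} (hq : Function.Injective q)
    {S : Finset (Sym2 V)} (h : pathEdges q ⊆ S) :
    (SimpleGraph.fromEdgeSet (S : Set (Sym2 V))).edist (q 0) (q (Fin.last l)) ≤ l := by
  have key : ∀ k : Fin (l + 1),
      (SimpleGraph.fromEdgeSet (S : Set (Sym2 V))).edist (q 0) (q k) ≤ (k : ℕ) := by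
    intro k
    induction k using Fin.induction with
    | zero => simp
    | succ k ih =>
      have hk : s(q k.castSucc, q k.succ) ∈ pathEdges q :=
        Finset.mem_image_of_mem _ (Finset.mem_univ k)
      have hadj : (SimpleGraph.fromEdgeSet (S : Set (Sym2 V))).Adj (q k.castSucc) (q k.succ) :=
        (SimpleGraph.fromEdgeSet_adj _).2
          ⟨by exact_mod_cast h hk, fun h => (Fin.castSucc_lt_succ (i := k)).ne (hq h)⟩
      refine SimpleGraph.edist_triangle.trans
        ((add_le_add ih (SimpleGraph.edist_eq_one_iff_adj.2 hadj).le).trans ?_)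
      simp
  simpa using key (Fin.last l)

/-- The self-avoiding sequences of length `l` whose end points form a pair of `T` and whose other
vertices are not in `U`. -/
def paths (l : ℕ) (T : Finset (V × V)) (U : Finset V) : Finset (Fin (l + 1) → V) :=
  Finset.univ.filter fun q => Function.Injective q ∧ (q 0, q (Fin.last l)) ∈ T ∧
    ∀ k, k ≠ 0 → k ≠ Fin.last l → q k ∉ U

lemma mem_paths {l : ℕ} {T : Finset (V × V)} {U : Finset V} {q : Fin (l + 1) → V} :
    q ∈ paths l T U ↔ Function.Injective q ∧ (q 0, q (Fin.last l)) ∈ T ∧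
      ∀ k, k ≠ 0 → k ≠ Fin.last l → q k ∉ U := by
  simp [paths]

/-- The sequence of the vertices other than the end points. -/
def interiorSeq {m : ℕ} (q : Fin (m + 1 + 1) → V) (i : Fin m) : V := q i.succ.castSucc

lemma eq_of_interiorSeq_eq {m : ℕ} {q q' : Fin (m + 1 + 1) → V} (h0 : q 0 = q' 0)
    (hl : q (Fin.last _) = q' (Fin.last _)) (hi : interiorSeq q = interiorSeq q') : q = q' := by
  ext k
  refine Fin.lastCases hl (fun k => ?_) k
  refine Fin.cases h0 (fun i => congrFun hi i) k

lemma card_paths_le (m : ℕ) (T : Finset (V × V)) (U : Finset V) :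
    (paths (m + 1) T U).card ≤ T.card * Fintype.card V ^ m := by
  have h := Finset.card_le_card_of_injOn (s := paths (m + 1) T U)
    (t := T ×ˢ (Finset.univ : Finset (Fin m → V)))
    (fun q => ((q 0, q (Fin.last _)), interiorSeq q))
    (fun q hq => by simpa using (mem_paths.1 hq).2.1)
    (fun q _ q' _ h => by
      simp only [Prod.mk.injEq] at h
      exact eq_of_interiorSeq_eq h.1.1 h.1.2 h.2)
  simpa using h

/-- The interior is an injection of `m` points into the complement of `U`. The bound 4 on `U` is for
the end points of two pairs, and `m + 4` absorbs both these and the vertices already used. -/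
lemma le_card_paths (m : ℕ) {T : Finset (V × V)} {U : Finset V} (hT : ∀ t ∈ T, t.1 < t.2)
    (hU : ∀ t ∈ T, t.1 ∈ U ∧ t.2 ∈ U) (hc : U.card ≤ 4) :
    T.card * (Fintype.card V - (m + 4)) ^ m ≤ (paths (m + 1) T U).card := by
  have h := Finset.card_le_card_of_injOn
    (s := T ×ˢ (Finset.univ : Finset (Fin m ↪ {v // v ∉ U})))
    (t := paths (m + 1) T U)
    (fun z => Fin.cons z.1.1 (Fin.snoc (fun i => (z.2 i : V)) z.1.2 : Fin (m + 1) → V)) ?_ ?_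
  · refine le_trans ?_ h
    rw [Finset.card_product, Finset.card_univ, Fintype.card_embedding_eq, Fintype.card_fin]
    refine Nat.mul_le_mul_left _ (le_trans ?_ (Nat.pow_sub_le_descFactorial _ _))
    refine Nat.pow_le_pow_left ?_ _
    have : Fintype.card {v // v ∉ U} = Fintype.card V - U.card := by
      rw [Fintype.card_subtype_compl, Fintype.card_coe]
    omega
  · rintro ⟨t, f⟩ ht
    have ht : t ∈ T := by simpa using ht
    have h1 : ∀ i, (f i : V) ≠ t.1 := fun i h => (f i).2 (h ▸ (hU t ht).1)
    have h2 : ∀ i, (f i : V) ≠ t.2 := fun i h => (f i).2 (h ▸ (hU t ht).2)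
    refine mem_paths.2 ⟨?_, ?_, ?_⟩
    · rw [Fin.cons_injective_iff, Fin.snoc_injective_iff]
      refine ⟨?_, Subtype.val_injective.comp f.injective, ?_⟩
      · rintro ⟨k, hk⟩
        revert hk
        refine Fin.lastCases ?_ (fun i => ?_) k
        · simpa using (hT t ht).ne'
        · simpa using h1 i
      · rintro ⟨k, hk⟩
        exact h2 k hk
    · simpa [← Fin.succ_last] using ht
    · intro k hk0 hkl
      obtain ⟨k, rfl⟩ := Fin.exists_succ_eq.2 hk0
      obtain ⟨i, rfl⟩ := Fin.exists_castSucc_eq.2 (show k ≠ Fin.last m by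
        rintro rfl; exact hkl (Fin.succ_last _))
      simpa using (f i).2
  · rintro ⟨t, f⟩ - ⟨t', f'⟩ - h
    simp only [Fin.cons_inj, Fin.snoc_inj] at h
    obtain ⟨h1, h2, h3⟩ := h
    have : f = f' := by
      ext i
      exact congrFun h2 i
    rw [this, Prod.ext h1 h3]

/-- A self-avoiding sequence has an edge outside any other one of the same family. -/
lemma exists_edge_notMem_pathEdges {m : ℕ} {T : Finset (V × V)} {U : Finset V}
    (hT : ∀ t ∈ T, t.1 < t.2) (hU : ∀ t ∈ T, t.1 ∈ U ∧ t.2 ∈ U) {P Q : Fin (m + 1 + 1) → V}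
    (hP : P ∈ paths (m + 1) T U) (hQ : Q ∈ paths (m + 1) T U) (hPQ : Q ≠ P) :
    ∃ k : Fin (m + 1), s(Q k.castSucc, Q k.succ) ∉ pathEdges P := by
  by_contra! hall
  obtain ⟨hPi, hPT, hPU⟩ := mem_paths.1 hP
  obtain ⟨hQi, hQT, hQU⟩ := mem_paths.1 hQ
  have hend : ∀ v ∈ U, v ∈ Set.range P → v = P 0 ∨ v = P (Fin.last _) := by
    rintro _ hv ⟨k, rfl⟩
    by_contra! hne
    exact hPU k (fun h => hne.1 (h ▸ rfl)) (fun h => hne.2 (h ▸ rfl)) hv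
  have h0 := hend _ (hU _ hQT).1 (mem_range_of_mk_mem_pathEdges (hall 0)).1
  have hl := hend _ (hU _ hQT).2 (mem_range_of_mk_mem_pathEdges (hall (Fin.last m))).2
  have hltP := hT _ hPT
  have hltQ := hT _ hQT
  simp only at h0 hl hltP hltQ
  -- The ordering of the pairs in `T` excludes that `Q` runs from the end of `P` to its start.
  have h0' : Q 0 = P 0 := by
    rcases h0 with h | h
    · exact h
    · rcases hl with h' | h'
      · rw [h, h'] at hltQ; exact absurd hltP hltQ.not_gt
      · rw [h, h'] at hltQ; exact absurd hltQ (lt_irrefl _)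
  have key : ∀ k : ℕ, ∀ h : k < m + 1 + 1, Q ⟨k, h⟩ = P ⟨k, h⟩ := by
    intro k
    induction k using Nat.strong_induction_on with
    | _ k ih =>
      intro h
      rcases k with _ | k
      · exact h0'
      · have hk := ih k (Nat.lt_succ_self k) (by omega)
        obtain ⟨j, -, hj⟩ := Finset.mem_image.1 (hall ⟨k, by omega⟩)
        simp only [Fin.castSucc_mk, Fin.succ_mk] at hj
        rw [hk] at hj
        rcases Sym2.eq_iff.1 hj with ⟨h1, h2⟩ | ⟨h1, h2⟩
        · have hjk := congrArg Fin.val (hPi h1)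
          simp only [Fin.val_castSucc] at hjk
          rw [← h2]
          congr 1
          ext
          simp [hjk]
        -- Here `Q` would step backwards along `P`, to a vertex it has already visited.
        · have hjk := congrArg Fin.val (hPi h2)
          simp only [Fin.val_succ] at hjk
          have hlt : (j : ℕ) < k + 1 := by omega
          have h3 := ih j hlt (by omega)
          have h4 : Q ⟨j, by omega⟩ = Q ⟨k + 1, h⟩ := by rw [h3, ← h1]; rfl
          have := congrArg Fin.val (hQi h4)
          simp only at this
          omega
  exact hPQ (funext fun k => key k k.2)

/-- The number of common edges of two sequences is at most the number of interior vertices of the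
second one on the first one. -/
lemma card_pathEdges_inter_le {m : ℕ} {P Q : Fin (m + 1 + 1) → V}
    (h : ∃ k : Fin (m + 1), s(Q k.castSucc, Q k.succ) ∉ pathEdges P) :
    (pathEdges P ∩ pathEdges Q).card ≤
      (Finset.univ.filter fun i => interiorSeq Q i ∈ Finset.univ.image P).card := by
  obtain ⟨k0, hk0⟩ := h
  have hsub : pathEdges P ∩ pathEdges Q ⊆
      (Finset.univ.filter fun i => interiorSeq Q i ∈ Finset.univ.image P).image
        fun i => s(Q (k0.succAbove i).castSucc, Q (k0.succAbove i).succ) := by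
    intro e he
    obtain ⟨heP, heQ⟩ := Finset.mem_inter.1 he
    obtain ⟨k, -, rfl⟩ := Finset.mem_image.1 heQ
    -- Each edge of `Q` other than `k0` is charged to its end point on the side of `k0`; this is an
    -- interior vertex, and distinct edges get distinct ones.
    obtain ⟨i, rfl⟩ := Fin.exists_succAbove_eq (x := k) (y := k0) (by rintro rfl; exact hk0 heP)
    refine Finset.mem_image.2 ⟨i, Finset.mem_filter.2 ⟨Finset.mem_univ _, ?_⟩, rfl⟩
    have hr := mem_range_of_mk_mem_pathEdges heP
    suffices interiorSeq Q i ∈ Set.range P by simpa using this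
    unfold interiorSeq
    rcases lt_or_ge i.castSucc k0 with hlt | hge
    · rw [Fin.succAbove_of_castSucc_lt _ _ hlt, ← Fin.castSucc_succ] at hr
      exact hr.2
    · rw [Fin.succAbove_of_le_castSucc _ _ hge] at hr
      exact hr.1
  exact (Finset.card_le_card hsub).trans Finset.card_image_le

/-- The summand is a product over coordinates, with weight 1 on `R` and `r` elsewhere. The sum over
all sequences factorises, as does the sum over those missing `R`; their difference is at most `(x -
y) * m * x ^ (m - 1)`. -/
lemma sum_overlap_le (m : ℕ) (R : Finset V) {r : ℝ} (h0 : 0 ≤ r) :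
    ∑ f : Fin m → V with (∃ i, f i ∈ R),
      r ^ (m - (Finset.univ.filter fun i => f i ∈ R).card) ≤
    R.card * m * (R.card + r * Fintype.card V) ^ (m - 1) := by
  have hw : ∀ f : Fin m → V, r ^ (m - (Finset.univ.filter fun i => f i ∈ R).card) =
      ∏ i, if f i ∈ R then 1 else r := by
    intro f
    rw [Finset.prod_ite, Finset.prod_const_one, one_mul, Finset.prod_const]
    congr 1
    have := Finset.card_filter_add_card_filter_not (s := (Finset.univ : Finset (Fin m)))
      (fun i => f i ∈ R)
    rw [Finset.card_univ, Fintype.card_fin] at this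
    omega
  set b : ℝ := ∑ v : V, if v ∈ R then 0 else r with hb
  have hsum : ∑ v : V, (if v ∈ R then (1 : ℝ) else r) = R.card + b := by
    have : (R.card : ℝ) = ∑ v : V, if v ∈ R then (1 : ℝ) else 0 := by simp
    rw [this, hb, ← Finset.sum_add_distrib]
    exact Finset.sum_congr rfl fun v _ => by split_ifs <;> simp
  have hb0 : 0 ≤ b := Finset.sum_nonneg fun v _ => by split_ifs <;> simp [h0]
  have hb1 : b ≤ r * Fintype.card V := by
    calc b ≤ ∑ _v : V, r := Finset.sum_le_sum fun v _ => by split_ifs <;> simp [h0]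
      _ = _ := by simp [mul_comm]
  have htot : ∑ f : Fin m → V, ∏ i, (if f i ∈ R then (1 : ℝ) else r) = (R.card + b) ^ m := by
    rw [← hsum, Fintype.sum_pow]
  have hnone : ∑ f : Fin m → V with ¬(∃ i, f i ∈ R), ∏ i, (if f i ∈ R then (1 : ℝ) else r) =
      b ^ m := by
    rw [hb, Fintype.sum_pow, Finset.sum_filter]
    refine Finset.sum_congr rfl fun f _ => ?_
    split_ifs with hf
    · obtain ⟨i, hi⟩ := hf
      exact (Finset.prod_eq_zero (Finset.mem_univ i) (by simp [hi])).symm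
    · push Not at hf
      exact Finset.prod_congr rfl fun i _ => by simp [hf i]
  have hsplit := Finset.sum_filter_add_sum_filter_not (Finset.univ : Finset (Fin m → V))
    (fun f => ∃ i, f i ∈ R) (fun f => ∏ i, if f i ∈ R then (1 : ℝ) else r)
  rw [htot, hnone] at hsplit
  rw [Finset.sum_congr rfl fun f _ => hw f, eq_sub_of_add_eq hsplit]
  refine (le_abs_self _).trans ((abs_pow_sub_pow_le _ _ _).trans ?_)
  have hR : (0 : ℝ) ≤ R.card := Nat.cast_nonneg _
  rw [add_sub_cancel_right, abs_of_nonneg hR, abs_of_nonneg (by positivity), abs_of_nonneg hb0,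
    max_eq_left (by linarith)]
  gcongr

/-- Upper bound for the probability that all pairs of `T` are remote. -/
theorem bernoulliMean_prod_remoteInd_le (m : ℕ) {T : Finset (V × V)} {U : Finset V}
    (hT : ∀ t ∈ T, t.1 < t.2) (hU : ∀ t ∈ T, t.1 ∈ U ∧ t.2 ∈ U) (hc : U.card ≤ 4)
    {r : ℝ} (h0 : 0 ≤ r) (h1 : r ≤ 1) :
    bernoulliMean (edgeProb V r) (fun S => ∏ t ∈ T, remoteInd (m + 1) t.1 t.2 S) ≤
      Real.exp (-(T.card * ((Fintype.card V - (m + 4) : ℕ) : ℝ) ^ m * r ^ (m + 1)) +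
        T.card ^ 2 * (Fintype.card V : ℝ) ^ m * r ^ (m + 2) *
          ((m + 2) * m * (m + 2 + r * Fintype.card V) ^ (m - 1))) := by
  have hp := edgeProb_mem (V := V) h0 h1
  have hle : ∀ S, ∏ t ∈ T, remoteInd (m + 1) t.1 t.2 S ≤
      avoidsInd pathEdges (paths (m + 1) T U) S := by
    intro S
    by_cases hS : ∃ t ∈ T, remoteInd (m + 1) t.1 t.2 S = 0
    · obtain ⟨t, ht, ht0⟩ := hS
      rw [Finset.prod_eq_zero ht ht0]
      exact avoidsInd_nonneg _ _ _
    · push Not at hS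
      have hone : avoidsInd pathEdges (paths (m + 1) T U) S = 1 := by
        refine Finset.prod_eq_one fun q hq => ?_
        obtain ⟨hqi, hqT, -⟩ := mem_paths.1 hq
        have hnot : ¬pathEdges q ⊆ S := fun hsub =>
          hS _ hqT (if_neg (not_lt.2 (edist_le_of_pathEdges_subset hqi hsub)))
        rw [containsInd, if_neg hnot, sub_zero]
      rw [hone]
      refine Finset.prod_le_one (fun t _ => ?_) fun t _ => ?_ <;>
        rcases remoteInd_eq_zero_or_one (m + 1) t.1 t.2 S with h | h <;> simp [h]
  refine (bernoulliMean_mono hp hle).trans ((bernoulliMean_avoidsInd_le hp _ _).trans ?_)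
  refine Real.exp_le_exp.2 (add_le_add (neg_le_neg ?_) ?_)
  · rw [Finset.sum_congr rfl fun q hq => by
      rw [prod_edgeProb fun e he => not_isDiag_of_mem_pathEdges (mem_paths.1 hq).1 he,
        card_pathEdges (mem_paths.1 hq).1], Finset.sum_const, nsmul_eq_mul]
    refine mul_le_mul_of_nonneg_right ?_ (pow_nonneg h0 _)
    exact_mod_cast le_card_paths m hT hU hc
  · have hone : ∀ P ∈ paths (m + 1) T U,
        ∑ Q ∈ paths (m + 1) T U with Q ≠ P ∧ ¬Disjoint (pathEdges P) (pathEdges Q),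
          ∏ e ∈ pathEdges P ∪ pathEdges Q, edgeProb V r e ≤
        r ^ (m + 2) * (T.card * ((m + 2) * m * (m + 2 + r * Fintype.card V) ^ (m - 1))) := by
      intro P hP
      have hPi := (mem_paths.1 hP).1
      set R := Finset.univ.image P with hR
      have hRc : R.card = m + 2 := by
        rw [hR, Finset.card_image_of_injective _ hPi, Finset.card_univ, Fintype.card_fin]
      set w : (Fin m → V) → ℝ := fun f => r ^ (m - (Finset.univ.filter fun i => f i ∈ R).card)
        with hw
      have hterm : ∀ Q ∈ (paths (m + 1) T U).filter
          (fun Q => Q ≠ P ∧ ¬Disjoint (pathEdges P) (pathEdges Q)),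
          (∃ i, interiorSeq Q i ∈ R) ∧
          ∏ e ∈ pathEdges P ∪ pathEdges Q, edgeProb V r e ≤ r ^ (m + 2) * w (interiorSeq Q) := by
        intro Q hQ
        obtain ⟨hQ, hne, hdis⟩ := Finset.mem_filter.1 hQ
        have hQi := (mem_paths.1 hQ).1
        have hcard := card_pathEdges_inter_le (exists_edge_notMem_pathEdges hT hU hP hQ hne)
        have hpos : 0 < (pathEdges P ∩ pathEdges Q).card :=
          Finset.card_pos.2 (Finset.not_disjoint_iff_nonempty_inter.1 hdis)
        constructor
        · obtain ⟨i, hi⟩ := Finset.card_pos.1 (hpos.trans_le hcard)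
          exact ⟨i, (Finset.mem_filter.1 hi).2⟩
        · rw [prod_edgeProb fun e he => (Finset.mem_union.1 he).elim
            (not_isDiag_of_mem_pathEdges hPi) (not_isDiag_of_mem_pathEdges hQi), hw, ← pow_add]
          refine pow_le_pow_of_le_one h0 h1 ?_
          rw [← hR] at hcard
          -- The union has `2 * (m + 1)` edges minus the common ones, whose number is at most that
          -- of the interior vertices of `Q` on `P`.
          have hun := Finset.card_union_add_card_inter (pathEdges P) (pathEdges Q)
          rw [card_pathEdges hPi, card_pathEdges hQi] at hun
          have hm : (Finset.univ.filter fun i => interiorSeq Q i ∈ R).card ≤ m :=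
            (Finset.card_le_univ _).trans_eq (Fintype.card_fin m)
          omega
      refine (Finset.sum_le_sum fun Q hQ => (hterm Q hQ).2).trans ?_
      rw [← Finset.mul_sum]
      refine mul_le_mul_of_nonneg_left ?_ (pow_nonneg h0 _)
      have hw0 : ∀ f, 0 ≤ w f := fun f => pow_nonneg h0 _
      calc _ = ∑ z ∈ ((paths (m + 1) T U).filter
              (fun Q => Q ≠ P ∧ ¬Disjoint (pathEdges P) (pathEdges Q))).image
              (fun Q => ((Q 0, Q (Fin.last _)), interiorSeq Q)), w z.2 := by
            rw [Finset.sum_image]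
            intro Q _ Q' _ h
            simp only [Prod.mk.injEq] at h
            exact eq_of_interiorSeq_eq h.1.1 h.1.2 h.2
        _ ≤ ∑ z ∈ T ×ˢ (Finset.univ.filter fun f : Fin m → V => ∃ i, f i ∈ R), w z.2 := by
            refine Finset.sum_le_sum_of_subset_of_nonneg (fun z hz => ?_) fun z _ _ => hw0 _
            obtain ⟨Q, hQ, rfl⟩ := Finset.mem_image.1 hz
            exact Finset.mem_product.2 ⟨(mem_paths.1 (Finset.mem_filter.1 hQ).1).2.1,
              Finset.mem_filter.2 ⟨Finset.mem_univ _, (hterm Q hQ).1⟩⟩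
        _ = T.card * ∑ f : Fin m → V with (∃ i, f i ∈ R), w f := by
            rw [Finset.sum_product]
            simp
        _ ≤ _ := by
            refine mul_le_mul_of_nonneg_left ?_ (Nat.cast_nonneg _)
            have := sum_overlap_le m R h0
            rw [hRc] at this
            push_cast at this
            exact this
    refine (Finset.sum_le_sum hone).trans ?_
    rw [Finset.sum_const, nsmul_eq_mul]
    have hcard : ((paths (m + 1) T U).card : ℝ) ≤ T.card * (Fintype.card V : ℝ) ^ m := by
      exact_mod_cast card_paths_le m T U
    refine (mul_le_mul_of_nonneg_right hcard (by positivity)).trans_eq ?_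
    ring

/-- Lower bound for the probability that a pair is remote. -/
theorem le_bernoulliMean_remoteInd (d : ℕ) {x y : V} (hxy : x ≠ y) {r : ℝ} (h0 : 0 ≤ r)
    (h1 : r ≤ 1) :
    ∏ l ∈ Finset.range d, (1 - r ^ (l + 1)) ^ (Fintype.card V ^ l) ≤
      bernoulliMean (edgeProb V r) (remoteInd d x y) := by
  have hp := edgeProb_mem (V := V) h0 h1
  set J : Finset (Σ l : Fin d, (Fin (l + 1 + 1) → V)) :=
    Finset.univ.sigma fun l => paths (l + 1) {(x, y)} ∅ with hJ
  have hle : ∀ S, avoidsInd (fun z : Σ l : Fin d, (Fin (l + 1 + 1) → V) => pathEdges z.2) J S ≤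
      remoteInd d x y S := by
    intro S
    unfold remoteInd
    split_ifs with h
    · exact avoidsInd_le_one _ _ _
    · refine le_of_eq ?_
      have h := not_lt.1 h
      obtain ⟨w, hw⟩ := SimpleGraph.exists_walk_of_edist_ne_top
        (ne_top_of_le_ne_top (ENat.natCast_ne_top d) h)
      -- A close pair is joined by a path of some length from 1 to `d`, hence by a sequence counted
      -- in `J`.
      have hwl : w.bypass.length ≤ d :=
        w.length_bypass_le_length.trans (by rw [← hw] at h; exact_mod_cast h)
      have hpath := w.bypass_isPath
      generalize w.bypass = w' at hwl hpath
      obtain ⟨l, hl⟩ : ∃ l, w'.length = l + 1 := by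
        refine Nat.exists_eq_succ_of_ne_zero fun h0 => ?_
        exact hxy (SimpleGraph.Walk.eq_of_length_eq_zero h0)
      refine Finset.prod_eq_zero
        (i := ⟨⟨l, by omega⟩, fun k : Fin (l + 1 + 1) => w'.getVert k⟩) ?_ ?_
      · refine Finset.mem_sigma.2 ⟨Finset.mem_univ _, mem_paths.2 ⟨?_, ?_, by simp⟩⟩
        · intro j k hjk
          exact Fin.ext (hpath.getVert_injOn (by simp; omega) (by simp; omega) hjk)
        · simp [← hl]
      · have : pathEdges (fun k : Fin (l + 1 + 1) => w'.getVert k) ⊆ S := by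
          intro e he
          obtain ⟨k, -, rfl⟩ := Finset.mem_image.1 he
          have := w'.adj_getVert_succ (i := k) (by omega)
          rw [SimpleGraph.fromEdgeSet_adj] at this
          exact_mod_cast this.1
        simp only [containsInd]
        rw [if_pos this, sub_self]
  refine le_trans ?_ ((prod_one_sub_le_bernoulliMean_avoidsInd hp _ J).trans
    (bernoulliMean_mono hp hle))
  rw [hJ, Finset.prod_sigma, ← Fin.prod_univ_eq_prod_range
    (fun l => (1 - r ^ (l + 1)) ^ (Fintype.card V ^ l))]
  refine Finset.prod_le_prod (fun l _ => ?_) fun l _ => ?_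
  · exact pow_nonneg (sub_nonneg.2 (pow_le_one₀ h0 h1)) _
  · have : ∀ q ∈ paths ((l : ℕ) + 1) {(x, y)} (∅ : Finset V),
        1 - ∏ e ∈ pathEdges q, edgeProb V r e = 1 - r ^ ((l : ℕ) + 1) := fun q hq => by
      rw [prod_edgeProb fun e he => not_isDiag_of_mem_pathEdges (mem_paths.1 hq).1 he,
        card_pathEdges (mem_paths.1 hq).1]
    rw [Finset.prod_congr rfl this, Finset.prod_const]
    refine pow_le_pow_of_le_one (sub_nonneg.2 (pow_le_one₀ h0 h1))
      (by linarith [pow_nonneg h0 ((l : ℕ) + 1)]) ?_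
    simpa using card_paths_le (l : ℕ) {(x, y)} (∅ : Finset V)

end Paths

/-! ### Limits of the bounds in the regime `r ^ (m + 1) * n ^ m = log (n² / c)`. -/

section Asymptotics

open Topology

/-- The lower bound for the probability that a pair of `n` vertices has no path of length at most
`m + 1`. -/
noncomputable def remoteLower (m n : ℕ) (r : ℝ) : ℝ :=
  ∏ l ∈ Finset.range (m + 1), (1 - r ^ (l + 1)) ^ (n ^ l)

/-- The upper bound for the probability that `k` pairs of `n` vertices have no path of length
`m + 1`. -/
noncomputable def remoteUpper (m k n : ℕ) (r : ℝ) : ℝ :=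
  Real.exp (-(k * ((n - (m + 4) : ℕ) : ℝ) ^ m * r ^ (m + 1)) +
    k ^ 2 * (n : ℝ) ^ m * r ^ (m + 2) * ((m + 2) * m * (m + 2 + r * n) ^ (m - 1)))

variable {c : ℝ}

lemma log_sq_div_eq (hc : 0 < c) (n : ℕ) :
    Real.log ((n : ℝ) ^ 2 / c) = 2 * Real.log (n / √c) := by
  rw [← Real.sq_sqrt hc.le, ← div_pow, Real.log_pow, Real.sqrt_sq (Real.sqrt_nonneg c)]
  norm_num

lemma tendsto_natCast_div_sqrt (hc : 0 < c) :
    Tendsto (fun n : ℕ => (n : ℝ) / √c) atTop atTop :=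
  tendsto_natCast_atTop_atTop.atTop_div_const (Real.sqrt_pos.2 hc)

lemma tendsto_log_sq_div (hc : 0 < c) :
    Tendsto (fun n : ℕ => Real.log ((n : ℝ) ^ 2 / c)) atTop atTop := by
  simp only [log_sq_div_eq hc]
  exact (Real.tendsto_log_atTop.comp (tendsto_natCast_div_sqrt hc)).const_mul_atTop two_pos

lemma tendsto_log_sq_div_pow_div (hc : 0 < c) (k : ℕ) :
    Tendsto (fun n : ℕ => Real.log ((n : ℝ) ^ 2 / c) ^ k / n) atTop (𝓝 0) := by
  have h := ((Real.isLittleO_pow_log_id_atTop (n := k)).tendsto_div_nhds_zero.comp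
    (tendsto_natCast_div_sqrt hc)).const_mul (2 ^ k / √c)
  rw [mul_zero] at h
  refine h.congr fun n => ?_
  have := (Real.sqrt_pos.2 hc).ne'
  simp only [Function.comp_apply, id, log_sq_div_eq hc]
  rcases eq_or_ne (n : ℝ) 0 with hn | hn
  · simp [hn]
  · rw [mul_pow]
    field_simp

variable {m : ℕ} {r : ℕ → ℝ}

lemma eventually_mul_pow (hr : ∀ᶠ n : ℕ in atTop, 0 < r n ∧ r n < 1 ∧
      r n ^ (m + 1) * (n : ℝ) ^ m = Real.log ((n : ℝ) ^ 2 / c)) :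
    ∀ᶠ n : ℕ in atTop, (r n * n) ^ (m + 1) = n * Real.log ((n : ℝ) ^ 2 / c) := by
  filter_upwards [hr] with n hn
  rw [← hn.2.2]; ring

lemma tendsto_zero_of_pow {f : ℕ → ℝ} {k : ℕ} (hk : k ≠ 0) (hf : ∀ᶠ n in atTop, 0 ≤ f n)
    (h : Tendsto (fun n => f n ^ k) atTop (𝓝 0)) : Tendsto f atTop (𝓝 0) := by
  have h2 := h.rpow_const (p := (k : ℝ)⁻¹) (Or.inr (by positivity))
  rw [Real.zero_rpow (by positivity)] at h2
  refine h2.congr' ?_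
  filter_upwards [hf] with n hn
  exact Real.pow_rpow_inv_natCast hn hk

/-- With `L` the logarithm, `(r n) ^ (m + 1) = n L`, so the `(m + 1)`-th power of the quotient is `L
^ (2 * m + 1) / n`. This quotient bounds Janson's correction. -/
lemma tendsto_log_sq_div_mul (hc : 0 < c) (hr : ∀ᶠ n : ℕ in atTop, 0 < r n ∧ r n < 1 ∧
      r n ^ (m + 1) * (n : ℝ) ^ m = Real.log ((n : ℝ) ^ 2 / c)) :
    Tendsto (fun n : ℕ => Real.log ((n : ℝ) ^ 2 / c) ^ 2 / (r n * n)) atTop (𝓝 0) := by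
  refine tendsto_zero_of_pow (k := m + 1) (by omega) ?_ ?_
  · filter_upwards [hr] with n hn
    have := hn.1
    positivity
  · refine (tendsto_log_sq_div_pow_div hc (2 * m + 1)).congr' ?_
    filter_upwards [eventually_mul_pow hr, (tendsto_log_sq_div hc).eventually_gt_atTop 0,
      eventually_gt_atTop 0] with n hn hL hn0
    have hn0 : (0 : ℝ) < n := Nat.cast_pos.2 hn0
    rw [div_pow, hn, ← pow_mul, div_eq_div_iff hn0.ne' (by positivity)]
    ring

lemma tendsto_mul_natCast (hc : 0 < c) (hr : ∀ᶠ n : ℕ in atTop, 0 < r n ∧ r n < 1 ∧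
      r n ^ (m + 1) * (n : ℝ) ^ m = Real.log ((n : ℝ) ^ 2 / c)) :
    Tendsto (fun n : ℕ => r n * n) atTop atTop := by
  have hinv : Tendsto (fun n : ℕ => (r n * n)⁻¹) atTop (𝓝[>] 0) := by
    refine tendsto_nhdsWithin_iff.2 ⟨?_, ?_⟩
    · refine squeeze_zero' ?_ ?_ (tendsto_log_sq_div_mul hc hr)
      · filter_upwards [hr] with n hn
        have := hn.1
        positivity
      · filter_upwards [hr, (tendsto_log_sq_div hc).eventually_ge_atTop 1] with n hn hL
        have := hn.1
        rw [inv_eq_one_div]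
        gcongr
        exact one_le_pow₀ hL
    · filter_upwards [hr, eventually_gt_atTop 0] with n hn hn0
      have := hn.1
      have hn0 : (0 : ℝ) < n := Nat.cast_pos.2 hn0
      exact Set.mem_Ioi.2 (by positivity)
  exact hinv.inv_tendsto_nhdsGT_zero.congr fun n => inv_inv _

lemma tendsto_log_sq_div_mul' (hc : 0 < c) (hr : ∀ᶠ n : ℕ in atTop, 0 < r n ∧ r n < 1 ∧
      r n ^ (m + 1) * (n : ℝ) ^ m = Real.log ((n : ℝ) ^ 2 / c)) :
    Tendsto (fun n : ℕ => Real.log ((n : ℝ) ^ 2 / c) / (r n * n)) atTop (𝓝 0) := by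
  refine squeeze_zero' ?_ ?_ (tendsto_log_sq_div_mul hc hr)
  · filter_upwards [hr, (tendsto_log_sq_div hc).eventually_ge_atTop 1] with n hn hL
    have := hn.1
    positivity
  · filter_upwards [hr, (tendsto_log_sq_div hc).eventually_ge_atTop 1] with n hn hL
    have := hn.1
    gcongr
    nlinarith

lemma exp_log_sq_div (hc : 0 < c) {n : ℕ} (hn : 0 < n) :
    (n : ℝ) ^ 2 = c * Real.exp (Real.log ((n : ℝ) ^ 2 / c)) := by
  rw [Real.exp_log (by positivity)]
  field_simp

/-- With `a = r n`, the expected number of paths of a shorter length `l + 1` is at most `a ^ m / n =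
L / a`, so those factors tend to 1. The longest length gives `(1 - x) ^ (n ^ m) ≈ exp (-L) = c /
n²`, where `x = r ^ (m + 1)`. -/
lemma tendsto_remoteLower (hc : 0 < c) (hm : 1 ≤ m) (hr : ∀ᶠ n : ℕ in atTop, 0 < r n ∧ r n < 1 ∧
      r n ^ (m + 1) * (n : ℝ) ^ m = Real.log ((n : ℝ) ^ 2 / c)) :
    Tendsto (fun n : ℕ => (n : ℝ) ^ 2 * remoteLower m n (r n)) atTop (𝓝 c) := by
  have hshort : ∀ l ∈ Finset.range m,
      Tendsto (fun n : ℕ => (1 - r n ^ (l + 1)) ^ (n ^ l)) atTop (𝓝 1) := by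
    intro l hl
    have hl : l + 1 ≤ m := Finset.mem_range.1 hl
    have h1 : Tendsto (fun n : ℕ => 1 - Real.log ((n : ℝ) ^ 2 / c) / (r n * n)) atTop (𝓝 1) := by
      simpa using (tendsto_log_sq_div_mul' hc hr).const_sub 1
    refine tendsto_of_tendsto_of_tendsto_of_le_of_le' h1 tendsto_const_nhds ?_ ?_
    · filter_upwards [hr, eventually_mul_pow hr, (tendsto_mul_natCast hc hr).eventually_ge_atTop 1,
        eventually_gt_atTop 0] with n hn hpow ha hn0
      have hr0 := hn.1
      have hn0 : (0 : ℝ) < n := Nat.cast_pos.2 hn0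
      have hle : r n ^ (l + 1) ≤ 1 := pow_le_one₀ hr0.le hn.2.1.le
      have hB := one_add_mul_le_pow (a := -(r n ^ (l + 1))) (by linarith) (n ^ l)
      rw [← sub_eq_add_neg] at hB
      refine le_trans ?_ hB
      have : (n ^ l : ℕ) * r n ^ (l + 1) ≤ Real.log ((n : ℝ) ^ 2 / c) / (r n * n) := by
        rw [le_div_iff₀ (by positivity)]
        have h2 : (r n * n) ^ (l + 1) * (r n * n) ≤ n * Real.log ((n : ℝ) ^ 2 / c) := by
          rw [← hpow, pow_succ _ m]
          gcongr
        refine le_of_mul_le_mul_left ?_ hn0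
        refine le_trans (le_of_eq ?_) h2
        push_cast
        ring
      push_cast at this ⊢
      linarith
    · filter_upwards [hr] with n hn
      exact pow_le_one₀ (sub_nonneg.2 (pow_le_one₀ hn.1.le hn.2.1.le))
        (by linarith [pow_nonneg hn.1.le (l + 1)])
  have hx : Tendsto (fun n : ℕ => Real.log ((n : ℝ) ^ 2 / c) * r n ^ (m + 1)) atTop (𝓝 0) := by
    refine squeeze_zero' ?_ ?_ (tendsto_log_sq_div_pow_div hc 2)
    · filter_upwards [hr, (tendsto_log_sq_div hc).eventually_ge_atTop 1] with n hn hL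
      have := hn.1
      positivity
    · filter_upwards [hr, eventually_gt_atTop 0] with n hn hn0
      have hn0' : (1 : ℝ) ≤ n := Nat.one_le_cast.2 hn0
      have hr0 := hn.1
      rw [le_div_iff₀ (by linarith), ← hn.2.2]
      -- The condition `d ≥ 2` enters here: at least one interior vertex.
      have h1 : (n : ℝ) ≤ n ^ m := le_self_pow₀ hn0' (by omega)
      calc _ ≤ r n ^ (m + 1) * (n : ℝ) ^ m * r n ^ (m + 1) * (n : ℝ) ^ m := by gcongr
        _ = _ := by ring
  have hlong : Tendsto (fun n : ℕ => (n : ℝ) ^ 2 * (1 - r n ^ (m + 1)) ^ (n ^ m)) atTop (𝓝 c) := by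
    have h1 : Tendsto (fun n : ℕ =>
        c * Real.exp (-(2 * (Real.log ((n : ℝ) ^ 2 / c) * r n ^ (m + 1))))) atTop (𝓝 c) := by
      have := (Real.continuous_exp.tendsto _).comp (hx.const_mul 2).neg
      simpa using this.const_mul c
    refine tendsto_of_tendsto_of_tendsto_of_le_of_le' h1 tendsto_const_nhds ?_ ?_
    · filter_upwards [hr, hx.eventually_le_const (show (0 : ℝ) < 1 / 2 by norm_num),
        (tendsto_log_sq_div hc).eventually_ge_atTop 1, eventually_gt_atTop 0] with n hn hxn hL hn0
      have hr0 := hn.1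
      have hx0 : 0 < r n ^ (m + 1) := by positivity
      have hx2 : r n ^ (m + 1) ≤ 1 / 2 := by nlinarith
      have hsq := exp_log_sq_div hc hn0
      rw [← hn.2.2] at hsq ⊢
      rw [hsq, mul_assoc c]
      refine mul_le_mul_of_nonneg_left ?_ hc.le
      -- For `0 ≤ x ≤ 1/2`, `(1 + x + 2x²)(1 - x) = 1 + x²(1 - 2x) ≥ 1`. The quadratic term costs `n
      -- ^ m * 2x² = 2Lx`, which is negligible.
      have h2 : Real.exp (-(r n ^ (m + 1) + 2 * r n ^ (m + 1) * r n ^ (m + 1))) ≤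
          1 - r n ^ (m + 1) := by
        generalize r n ^ (m + 1) = x at hx0 hx2
        rw [Real.exp_neg, inv_le_comm₀ (Real.exp_pos _) (by linarith)]
        refine le_trans ?_ (Real.add_one_le_exp _)
        rw [inv_le_iff_one_le_mul₀ (by linarith)]
        nlinarith [mul_nonneg hx0.le hx0.le, mul_nonneg (mul_nonneg hx0.le hx0.le)
          (show 0 ≤ 1 - 2 * x by linarith)]
      have h3 := pow_le_pow_left₀ (Real.exp_pos _).le h2 (n ^ m)
      rw [← Real.exp_nat_mul] at h3
      refine le_trans (le_of_eq ?_) (mul_le_mul_of_nonneg_left h3 (Real.exp_pos _).le)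
      rw [← Real.exp_add]
      congr 1
      push_cast
      ring
    · filter_upwards [hr, eventually_gt_atTop 0] with n hn hn0
      have hr0 := hn.1
      have h2 : 1 - r n ^ (m + 1) ≤ Real.exp (-(r n ^ (m + 1))) := Real.one_sub_le_exp_neg _
      have h3 := pow_le_pow_left₀ (sub_nonneg.2 (pow_le_one₀ hr0.le hn.2.1.le)) h2 (n ^ m)
      rw [← Real.exp_nat_mul] at h3
      rw [exp_log_sq_div hc hn0]
      refine (mul_le_mul_of_nonneg_left h3 (by positivity)).trans_eq ?_
      rw [mul_assoc, ← Real.exp_add, ← hn.2.2]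
      push_cast
      rw [show r n ^ (m + 1) * (n : ℝ) ^ m + (n : ℝ) ^ m * -r n ^ (m + 1) = 0 by ring,
        Real.exp_zero, mul_one]
  have h := (tendsto_finsetProd _ hshort).mul hlong
  rw [Finset.prod_const_one, one_mul] at h
  refine h.congr fun n => ?_
  rw [remoteLower, Finset.prod_range_succ]
  ring

/-- Since `n ^ (2 * k) = c ^ k * exp (k * L)`, the exponent must cancel `k * L` up to `o(1)`.
Counting with `n - (m + 4)` loses `O(L / n)`; the overlap term is of order `L * r * a ^ (m - 1) = L²
/ a`, with `a = r n`. -/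
lemma tendsto_remoteUpper (hc : 0 < c) (hm : 1 ≤ m) (hr : ∀ᶠ n : ℕ in atTop, 0 < r n ∧ r n < 1 ∧
      r n ^ (m + 1) * (n : ℝ) ^ m = Real.log ((n : ℝ) ^ 2 / c)) (k : ℕ) :
    Tendsto (fun n : ℕ => ((n : ℝ) ^ 2) ^ k * remoteUpper m k n (r n)) atTop (𝓝 (c ^ k)) := by
  have h1 : Tendsto (fun n : ℕ => Real.log ((n : ℝ) ^ 2 / c) -
      ((n - (m + 4) : ℕ) : ℝ) ^ m * r n ^ (m + 1)) atTop (𝓝 0) := by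
    have h := (tendsto_log_sq_div_pow_div hc 1).const_mul ((m : ℝ) * (m + 4))
    rw [mul_zero] at h
    refine squeeze_zero' ?_ ?_ h
    · filter_upwards [hr] with n hn
      have hr0 := hn.1
      rw [← hn.2.2, sub_nonneg, mul_comm]
      gcongr
      omega
    · filter_upwards [hr, eventually_ge_atTop (m + 4), (tendsto_log_sq_div hc).eventually_ge_atTop 1]
        with n hn hnm hL
      have hr0 := hn.1
      have hn0 : (0 : ℝ) < n := Nat.cast_pos.2 (by omega)
      have hnm' : (m + 4 : ℝ) ≤ n := by exact_mod_cast hnm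
      have hB := one_add_mul_le_pow (a := -((m + 4 : ℝ) / n))
        (by rw [neg_le_neg_iff]; exact ((div_le_one hn0).2 hnm').trans one_le_two) m
      have e : ((n - (m + 4) : ℕ) : ℝ) ^ m * r n ^ (m + 1) =
          (1 + -((m + 4 : ℝ) / n)) ^ m * Real.log ((n : ℝ) ^ 2 / c) := by
        have : ((n - (m + 4) : ℕ) : ℝ) = (1 + -((m + 4 : ℝ) / n)) * n := by
          rw [Nat.cast_sub hnm]
          push_cast
          field_simp
          ring
        rw [this, ← hn.2.2, mul_pow]
        ring
      rw [e, pow_one]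
      have := mul_le_mul_of_nonneg_right hB (zero_le_one.trans hL)
      have e2 : (m : ℝ) * (m + 4) * (Real.log ((n : ℝ) ^ 2 / c) / n) =
        -(m * -((m + 4 : ℝ) / n)) * Real.log ((n : ℝ) ^ 2 / c) := by ring
      rw [e2]
      linarith
  have h2 : Tendsto (fun n : ℕ => (n : ℝ) ^ m * r n ^ (m + 2) *
      ((m + 2) * m * (m + 2 + r n * n) ^ (m - 1))) atTop (𝓝 0) := by
    have h := (tendsto_log_sq_div_mul hc hr).const_mul (((m : ℝ) + 2) * m * 2 ^ (m - 1))
    rw [mul_zero] at h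
    refine squeeze_zero' ?_ ?_ h
    · filter_upwards [hr] with n hn
      have hr0 := hn.1
      positivity
    · filter_upwards [hr, eventually_mul_pow hr, eventually_gt_atTop 0,
        (tendsto_log_sq_div hc).eventually_ge_atTop 1,
        (tendsto_mul_natCast hc hr).eventually_ge_atTop ((m : ℝ) + 2)] with n hn hpow hn0 hL ha
      have hr0 := hn.1
      have hn0 : (0 : ℝ) < n := Nat.cast_pos.2 hn0
      obtain ⟨j, rfl⟩ : ∃ j, m = j + 1 := ⟨m - 1, by omega⟩
      rw [Nat.add_sub_cancel]
      set L := Real.log ((n : ℝ) ^ 2 / c) with hLdef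
      set a := r n * n with hadef
      have ha0 : 0 < a := by positivity
      have hle : ((j + 1 : ℕ) : ℝ) + 2 + a ≤ 2 * a := by linarith
      have e1 : r n * a ^ j = L / a := by
        rw [eq_div_iff ha0.ne']
        refine mul_left_cancel₀ hn0.ne' ?_
        rw [← hpow, hadef]
        ring
      calc (n : ℝ) ^ (j + 1) * r n ^ (j + 1 + 2) *
            ((((j + 1 : ℕ) : ℝ) + 2) * ((j + 1 : ℕ) : ℝ) * (((j + 1 : ℕ) : ℝ) + 2 + a) ^ j)
          = L * r n * ((((j + 1 : ℕ) : ℝ) + 2) * ((j + 1 : ℕ) : ℝ) *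
              (((j + 1 : ℕ) : ℝ) + 2 + a) ^ j) := by rw [← hn.2.2]; ring
        _ ≤ L * r n * ((((j + 1 : ℕ) : ℝ) + 2) * ((j + 1 : ℕ) : ℝ) * (2 * a) ^ j) := by
            gcongr
        _ = (((j + 1 : ℕ) : ℝ) + 2) * ((j + 1 : ℕ) : ℝ) * 2 ^ j * (L * (r n * a ^ j)) := by
            rw [mul_pow]; ring
        _ = _ := by rw [e1]; ring
  have h3 := (h1.const_mul (k : ℝ)).add (h2.const_mul ((k : ℝ) ^ 2))
  rw [mul_zero, mul_zero, add_zero] at h3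
  have h4 := ((Real.continuous_exp.tendsto _).comp h3).const_mul (c ^ k)
  rw [Real.exp_zero, mul_one] at h4
  refine h4.congr' ?_
  filter_upwards [eventually_gt_atTop 0] with n hn0
  rw [exp_log_sq_div hc hn0, mul_pow, ← Real.exp_nat_mul, remoteUpper, mul_assoc, ← Real.exp_add]
  simp only [Function.comp_apply]
  congr 2
  ring

end Asymptotics

/-! ### First and second moments of the number of remote pairs. -/

section RemotePairs

open Topology

/-- The pairs `x < y` of vertices. -/
def vertexPairs (n : ℕ) : Finset (Fin n × Fin n) := Finset.univ.filter fun t => t.1 < t.2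

lemma card_vertexPairs (n : ℕ) : ((vertexPairs n).card : ℝ) = n * (n - 1) / 2 := by
  have h : (vertexPairs n).card = ∑ i ∈ Finset.range n, i := by
    have hu : vertexPairs n = ((Finset.univ : Finset (Fin n)).sigma
        fun y => Finset.Iio y).map ⟨fun z => (z.2, z.1), fun a b h => by
          simp only [Prod.mk.injEq] at h
          exact Sigma.ext h.2 (heq_of_eq h.1)⟩ := by
      ext ⟨x, y⟩
      simp only [vertexPairs, Finset.mem_filter, Finset.mem_univ, true_and, Finset.mem_map,
        Finset.mem_sigma, Finset.mem_Iio, Sigma.exists]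
      exact ⟨fun h => ⟨y, x, h, rfl⟩, fun ⟨a, b, h, hab⟩ => by cases hab; exact h⟩
    rw [hu, Finset.card_map, Finset.card_sigma, ← Fin.sum_univ_eq_sum_range]
    simp
  have h2 := Finset.sum_range_id_mul_two n
  rw [← h] at h2
  have h3 : ((vertexPairs n).card : ℝ) * 2 = n * ((n - 1 : ℕ) : ℝ) := by exact_mod_cast h2
  rcases n with _ | n
  · simpa using h3
  · push_cast [Nat.add_sub_cancel] at h3 ⊢
    linarith

lemma bernoulliMean_prod_remoteInd_le_remoteUpper (m : ℕ) {n : ℕ} {T : Finset (Fin n × Fin n)}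
    (hT : ∀ t ∈ T, t.1 < t.2) (hc : T.card ≤ 2) {r : ℝ} (h0 : 0 ≤ r) (h1 : r ≤ 1) :
    bernoulliMean (edgeProb (Fin n) r) (fun S => ∏ t ∈ T, remoteInd (m + 1) t.1 t.2 S) ≤
      remoteUpper m T.card n r := by
  have h := bernoulliMean_prod_remoteInd_le m (T := T)
    (U := T.image Prod.fst ∪ T.image Prod.snd) hT
    (fun t ht => ⟨Finset.mem_union_left _ (Finset.mem_image_of_mem _ ht),
      Finset.mem_union_right _ (Finset.mem_image_of_mem _ ht)⟩)
    ((Finset.card_union_le _ _).trans (by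
      have h1 := Finset.card_image_le (s := T) (f := Prod.fst)
      have h2 := Finset.card_image_le (s := T) (f := Prod.snd)
      omega)) h0 h1
  rwa [Fintype.card_fin] at h

lemma bernoulliMean_remoteInd_le (m : ℕ) {n : ℕ} {t : Fin n × Fin n} (ht : t ∈ vertexPairs n)
    {r : ℝ} (h0 : 0 ≤ r) (h1 : r ≤ 1) :
    bernoulliMean (edgeProb (Fin n) r) (remoteInd (m + 1) t.1 t.2) ≤ remoteUpper m 1 n r := by
  have h := bernoulliMean_prod_remoteInd_le_remoteUpper m (T := {t})
    (by simpa [vertexPairs] using ht) (by simp) h0 h1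
  simpa using h

lemma bernoulliMean_remoteInd_mul_le (m : ℕ) {n : ℕ} {t u : Fin n × Fin n}
    (ht : t ∈ vertexPairs n) (hu : u ∈ vertexPairs n) (htu : t ≠ u)
    {r : ℝ} (h0 : 0 ≤ r) (h1 : r ≤ 1) :
    bernoulliMean (edgeProb (Fin n) r)
      (fun S => remoteInd (m + 1) t.1 t.2 S * remoteInd (m + 1) u.1 u.2 S) ≤
      remoteUpper m 2 n r := by
  have h := bernoulliMean_prod_remoteInd_le_remoteUpper m (T := {t, u})
    (by simpa [vertexPairs] using And.intro (Finset.mem_filter.1 ht).2 (Finset.mem_filter.1 hu).2)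
    Finset.card_le_two h0 h1
  rw [Finset.card_pair htu] at h
  simpa only [Finset.prod_pair htu] using h

lemma remoteLower_le (m : ℕ) {n : ℕ} {t : Fin n × Fin n} (ht : t ∈ vertexPairs n)
    {r : ℝ} (h0 : 0 ≤ r) (h1 : r ≤ 1) :
    remoteLower m n r ≤ bernoulliMean (edgeProb (Fin n) r) (remoteInd (m + 1) t.1 t.2) := by
  have h := le_bernoulliMean_remoteInd (m + 1) (Finset.mem_filter.1 ht).2.ne h0 h1
  rwa [Fintype.card_fin] at h

lemma remoteLower_nonneg (m n : ℕ) {r : ℝ} (h0 : 0 ≤ r) (h1 : r ≤ 1) : 0 ≤ remoteLower m n r :=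
  Finset.prod_nonneg fun _ _ => pow_nonneg (sub_nonneg.2 (pow_le_one₀ h0 h1)) _

/-- A covariance is at most the upper bound for two pairs minus the square of the lower bound for
one. The absolute value makes the bound nonnegative, so the number of pairs may be replaced by `n²`.
-/
lemma dependence_remoteInd_le (m n : ℕ) {r : ℝ} (h0 : 0 ≤ r) (h1 : r ≤ 1) :
    dependence (edgeProb (Fin n) r) (fun t => remoteInd (m + 1) t.1 t.2) (vertexPairs n) ≤
      (n : ℝ) ^ 2 * (remoteUpper m 1 n r ^ 2 +
        (n : ℝ) ^ 2 * |remoteUpper m 2 n r - remoteLower m n r ^ 2|) := by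
  have hl := remoteLower_nonneg m n h0 h1
  have hcard : (vertexPairs n).card ≤ n ^ 2 := by
    refine (Finset.card_le_univ _).trans_eq ?_
    simp [sq]
  have hcard' : ((vertexPairs n).card : ℝ) ≤ (n : ℝ) ^ 2 := by exact_mod_cast hcard
  refine (Finset.sum_le_card_nsmul _ _ (remoteUpper m 1 n r ^ 2 +
        (n : ℝ) ^ 2 * |remoteUpper m 2 n r - remoteLower m n r ^ 2|) fun t ht => ?_).trans ?_
  · refine add_le_add ?_ ?_
    · exact pow_le_pow_left₀ (hl.trans (remoteLower_le m ht h0 h1))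
        (bernoulliMean_remoteInd_le m ht h0 h1) 2
    · refine (Finset.sum_le_card_nsmul _ _ |remoteUpper m 2 n r - remoteLower m n r ^ 2|
        fun u hu => ?_).trans ?_
      · obtain ⟨hne, hu⟩ := Finset.mem_erase.1 hu
        refine le_trans ?_ (le_abs_self _)
        rw [sq]
        exact sub_le_sub (bernoulliMean_remoteInd_mul_le m ht hu hne.symm h0 h1)
          (mul_le_mul (remoteLower_le m ht h0 h1) (remoteLower_le m hu h0 h1) hl
            (hl.trans (remoteLower_le m ht h0 h1)))
      · rw [nsmul_eq_mul]
        refine mul_le_mul_of_nonneg_right (le_trans ?_ hcard') (abs_nonneg _)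
        exact_mod_cast Finset.card_le_card (Finset.erase_subset _ _)
  · rw [nsmul_eq_mul]
    exact mul_le_mul_of_nonneg_right hcard' (by positivity)

variable {c : ℝ} {m : ℕ} {r : ℕ → ℝ}

lemma tendsto_sum_bernoulliMean_remoteInd (hc : 0 < c) (hm : 1 ≤ m)
    (h01 : ∀ n, 0 ≤ r n ∧ r n ≤ 1) (hr : ∀ᶠ n : ℕ in atTop, 0 < r n ∧ r n < 1 ∧
      r n ^ (m + 1) * (n : ℝ) ^ m = Real.log ((n : ℝ) ^ 2 / c)) :
    Tendsto (fun n => ∑ t ∈ vertexPairs n,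
      bernoulliMean (edgeProb (Fin n) (r n)) (remoteInd (m + 1) t.1 t.2)) atTop (𝓝 (c / 2)) := by
  have hratio : Tendsto (fun n : ℕ => ((vertexPairs n).card : ℝ) / (n : ℝ) ^ 2) atTop
      (𝓝 (1 / 2)) := by
    have h : Tendsto (fun n : ℕ => (1 - (n : ℝ)⁻¹) / 2) atTop (𝓝 (1 / 2)) := by
      simpa using (tendsto_inv_atTop_nhds_zero_nat (𝕜 := ℝ)).const_sub 1 |>.div_const 2
    refine h.congr' ?_
    filter_upwards [eventually_gt_atTop 0] with n hn
    have : (n : ℝ) ≠ 0 := by positivity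
    rw [card_vertexPairs]
    field_simp
  have hlow := hratio.mul (tendsto_remoteLower hc hm hr)
  have hup := hratio.mul (tendsto_remoteUpper hc hm hr 1)
  rw [show 1 / 2 * c = c / 2 by ring] at hlow
  rw [pow_one, show 1 / 2 * c = c / 2 by ring] at hup
  refine tendsto_of_tendsto_of_tendsto_of_le_of_le' hlow hup ?_ ?_
  · filter_upwards [eventually_gt_atTop 0] with n hn
    have : (n : ℝ) ≠ 0 := by positivity
    rw [← mul_assoc, div_mul_cancel₀ _ (by positivity), ← nsmul_eq_mul]
    exact Finset.card_nsmul_le_sum _ _ _ fun t ht => remoteLower_le m ht (h01 n).1 (h01 n).2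
  · filter_upwards [eventually_gt_atTop 0] with n hn
    have : (n : ℝ) ≠ 0 := by positivity
    rw [← mul_assoc, pow_one, div_mul_cancel₀ _ (by positivity), ← nsmul_eq_mul]
    exact Finset.sum_le_card_nsmul _ _ _ fun t ht =>
      bernoulliMean_remoteInd_le m ht (h01 n).1 (h01 n).2

lemma tendsto_dependence_bound (hc : 0 < c) (hm : 1 ≤ m)
    (hr : ∀ᶠ n : ℕ in atTop, 0 < r n ∧ r n < 1 ∧
      r n ^ (m + 1) * (n : ℝ) ^ m = Real.log ((n : ℝ) ^ 2 / c)) :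
    Tendsto (fun n : ℕ => (n : ℝ) ^ 2 * (remoteUpper m 1 n (r n) ^ 2 +
        (n : ℝ) ^ 2 * |remoteUpper m 2 n (r n) - remoteLower m n (r n) ^ 2|)) atTop (𝓝 0) := by
  have hl := tendsto_remoteLower hc hm hr
  have hu := tendsto_remoteUpper hc hm hr 1
  have hv := tendsto_remoteUpper hc hm hr 2
  have hsq : Tendsto (fun n : ℕ => ((n : ℝ) ^ 2)⁻¹) atTop (𝓝 0) :=
    ((tendsto_pow_atTop two_ne_zero).comp tendsto_natCast_atTop_atTop).inv_tendsto_atTop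
  have h1 := (hu.pow 2).mul hsq
  have h2 := (hv.sub (hl.pow 2)).abs
  rw [mul_zero] at h1
  rw [sub_self, abs_zero] at h2
  have h3 := h1.add h2
  rw [add_zero] at h3
  refine h3.congr' ?_
  filter_upwards [eventually_gt_atTop 0] with n hn
  have hn' : (n : ℝ) ≠ 0 := by positivity
  have e : ((n : ℝ) ^ 2) ^ 2 * remoteUpper m 2 n (r n) - ((n : ℝ) ^ 2 * remoteLower m n (r n)) ^ 2 =
      ((n : ℝ) ^ 2 * (n : ℝ) ^ 2) * (remoteUpper m 2 n (r n) - remoteLower m n (r n) ^ 2) := by ring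
  rw [e, abs_mul, abs_of_nonneg (by positivity)]
  field_simp

lemma tendsto_bernoulliMeanC_remoteInd (hc : 0 < c) (hm : 1 ≤ m)
    (h01 : ∀ n, 0 ≤ r n ∧ r n ≤ 1) (hr : ∀ᶠ n : ℕ in atTop, 0 < r n ∧ r n < 1 ∧
      r n ^ (m + 1) * (n : ℝ) ^ m = Real.log ((n : ℝ) ^ 2 / c)) (t : ℝ) :
    Tendsto (fun n => bernoulliMeanC (edgeProb (Fin n) (r n)) fun S =>
      Complex.exp ((t * ∑ q ∈ vertexPairs n, remoteInd (m + 1) q.1 q.2 S : ℝ) * Complex.I)) atTop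
      (𝓝 (Complex.exp ((c / 2 : ℝ) * (Complex.exp (t * Complex.I) - 1)))) := by
  have hl := tendsto_sum_bernoulliMean_remoteInd hc hm h01 hr
  have hexp := ((Complex.continuous_ofReal.tendsto _).comp hl).mul_const
    (Complex.exp (t * Complex.I) - 1)
  have hexp := (Complex.continuous_exp.tendsto _).comp hexp
  have hb := ((tendsto_dependence_bound hc hm hr).const_mul (2 * t ^ 2)).mul
    ((Real.continuous_exp.tendsto _).comp (hl.const_mul 2))
  rw [mul_zero, zero_mul] at hb
  have hdiff := squeeze_zero_norm (fun n => (norm_bernoulliMeanC_sub_poisson_le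
    (edgeProb_mem (V := Fin n) (h01 n).1 (h01 n).2)
    (X := fun q : Fin n × Fin n => remoteInd (m + 1) q.1 q.2)
    (fun q S => remoteInd_eq_zero_or_one _ _ _ _) (fun q => remoteInd_antitone _ _ _)
    (vertexPairs n) t).trans (by
      refine mul_le_mul_of_nonneg_right ?_ (Real.exp_pos _).le
      exact mul_le_mul_of_nonneg_left (dependence_remoteInd_le m n (h01 n).1 (h01 n).2)
        (by positivity))) hb
  simpa using hdiff.add hexp

end RemotePairs

/-! ### Transfer to the random graph measure and to convergence in distribution. -/

section BinomialRandomGraph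

open Topology

/-- A graph is determined by its edge set. With finitely many vertices, this makes every function
measurable and every integral a finite sum. -/
instance (V : Type*) [Countable V] : MeasurableSingletonClass (SimpleGraph V) where
  measurableSet_singleton G := by
    have : {G} = SimpleGraph.edgeSet ⁻¹' {G.edgeSet} := by ext H; simp
    rw [this]
    exact SimpleGraph.measurable_edgeSet (measurableSet_singleton _)

/-- Expectations with respect to the binomial random graph are expectations with respect to a
Bernoulli random set of edges. -/
lemma integral_binomialRandom {V : Type*} [Fintype V] [LinearOrder V] (p : unitInterval)
    (f : SimpleGraph V → ℂ) :
    ∫ G, f G ∂SimpleGraph.binomialRandom V p =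
      bernoulliMeanC (edgeProb V p) fun S => f (SimpleGraph.fromEdgeSet (S : Set (Sym2 V))) := by
  classical
  have : Fintype (SimpleGraph V) := Fintype.ofFinite _
  -- Edge sets with loops have weight zero, and the loopless ones correspond bijectively to graphs.
  have hdiag : ∀ S : Finset (Sym2 V), ¬(∀ e ∈ S, ¬e.IsDiag) →
      bernoulliWeight (edgeProb V p) S = 0 := by
    intro S hS
    push Not at hS
    obtain ⟨e, he, hd⟩ := hS
    exact Finset.prod_eq_zero (Finset.mem_univ e) (by simp [he, edgeProb, hd])
  have hweight : ∀ G : SimpleGraph V, (SimpleGraph.binomialRandom V p).real {G} =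
      bernoulliWeight (edgeProb V p) G.edgeFinset := by
    intro G
    have hcompl : ∏ e ∈ G.edgeFinsetᶜ, (1 - edgeProb V p e) =
        (1 - (p : ℝ)) ^ ((Nat.card V).choose 2 - G.edgeSet.ncard) := by
      have h1 : ∀ e, 1 - edgeProb V p e = if e.IsDiag then 1 else 1 - (p : ℝ) := by
        intro e; unfold edgeProb; split_ifs <;> simp
      simp only [h1]
      rw [Finset.prod_ite, Finset.prod_const_one, one_mul, Finset.prod_const]
      congr 1
      have h2 : G.edgeFinsetᶜ.filter (fun e => ¬e.IsDiag) =
          (Finset.univ.filter fun e : Sym2 V => ¬e.IsDiag) \ G.edgeFinset := by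
        ext e; simp [and_comm]
      rw [h2, Finset.card_sdiff_of_subset (fun e he => by
          simpa using G.not_isDiag_of_mem_edgeFinset he), ← Fintype.card_subtype,
        Sym2.card_subtype_not_diag, Nat.card_eq_fintype_card, Set.ncard_eq_toFinset_card',
        SimpleGraph.edgeFinset]
    rw [bernoulliWeight_eq, hcompl,
      prod_edgeProb fun e he => G.not_isDiag_of_mem_edgeFinset he, measureReal_def,
      SimpleGraph.binomialRandom_singleton, ENNReal.toReal_mul, ENNReal.toReal_pow,
      ENNReal.toReal_pow, Set.ncard_eq_toFinset_card', SimpleGraph.edgeFinset]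
    rfl
  rw [integral_fintype (Integrable.of_finite), bernoulliMeanC,
    ← Finset.sum_filter_of_ne (p := fun S : Finset (Sym2 V) => ∀ e ∈ S, ¬e.IsDiag) (fun S _ h => by
      by_contra hS
      exact h (by rw [hdiag S hS]; simp))]
  refine Finset.sum_bij' (fun G _ => G.edgeFinset)
    (fun S _ => SimpleGraph.fromEdgeSet (S : Set (Sym2 V))) ?_ ?_ ?_ ?_ ?_
  · intro G _
    simpa using fun e he => G.not_isDiag_of_mem_edgeSet he
  · simp
  · intro G _
    simp
  · intro S hS
    have hS := (Finset.mem_filter.1 hS).2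
    ext e
    simpa using hS e
  · intro G _
    rw [hweight, Complex.real_smul]
    simp

lemma remotePairs_fromEdgeSet (d : ℕ) {n : ℕ} (S : Finset (Sym2 (Fin n))) :
    (remotePairs d (SimpleGraph.fromEdgeSet (S : Set (Sym2 (Fin n)))) : ℝ) =
      ∑ q ∈ vertexPairs n, remoteInd d q.1 q.2 S := by
  classical
  rw [remotePairs, Set.ncard_eq_toFinset_card']
  simp only [remoteInd, Finset.sum_boole, vertexPairs, Finset.filter_filter]
  congr 2
  ext q
  simp

/-- Convergence of characteristic functions of `ℕ`-valued random variables implies convergence in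
distribution. -/
lemma tendstoInDistribution_nat_of_tendsto_charFun {Ω : ℕ → Type*} {Ω' : Type*}
    {mΩ : ∀ n, MeasurableSpace (Ω n)} {mΩ' : MeasurableSpace Ω'} {μ : ∀ n, Measure (Ω n)}
    [∀ n, IsProbabilityMeasure (μ n)] {μ' : Measure Ω'} [IsProbabilityMeasure μ']
    {X : ∀ n, Ω n → ℕ} {Z : Ω' → ℕ} (hX : ∀ n, AEMeasurable (X n) (μ n)) (hZ : AEMeasurable Z μ')
    (h : ∀ t : ℝ, Tendsto (fun n => charFun (((μ n).map (X n)).map (Nat.cast : ℕ → ℝ)) t) atTop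
      (𝓝 (charFun ((μ'.map Z).map (Nat.cast : ℕ → ℝ)) t))) :
    TendstoInDistribution X atTop Z μ μ' where
  forall_aemeasurable := hX
  aemeasurable_limit := hZ
  tendsto := by
    have hP : ∀ n, IsProbabilityMeasure ((μ n).map (X n)) := fun n =>
      Measure.isProbabilityMeasure_map (hX n)
    have hP' : IsProbabilityMeasure (μ'.map Z) := Measure.isProbabilityMeasure_map hZ
    have hcast : Measurable (Nat.cast : ℕ → ℝ) := .of_discrete
    have hR := ProbabilityMeasure.tendsto_iff_tendsto_charFun
      (μ := fun n => ⟨((μ n).map (X n)).map (Nat.cast : ℕ → ℝ),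
        Measure.isProbabilityMeasure_map hcast.aemeasurable⟩)
      (μ₀ := ⟨(μ'.map Z).map (Nat.cast : ℕ → ℝ),
        Measure.isProbabilityMeasure_map hcast.aemeasurable⟩) |>.2 h
    refine tendsto_of_forall_isOpen_le_liminf' fun G hG => ?_
    -- Open sets of `ℕ` are traces of open sets of `ℝ`, so the portmanteau criterion pulls back from
    -- `ℝ`.
    obtain ⟨H, hH, rfl⟩ := Nat.isClosedEmbedding_coe_real.isInducing.isOpen_iff.1 hG
    have := ProbabilityMeasure.le_liminf_measure_open_of_tendsto hR hH
    simpa [Measure.map_apply hcast hH.measurableSet] using this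

end BinomialRandomGraph

theorem proposition1 (c : ℝ) (hc : 0 < c) (d : ℕ) (hd : 2 ≤ d) (p : ℕ → unitInterval)
    (hp : ∀ᶠ n : ℕ in atTop, 0 < (p n : ℝ) ∧ (p n : ℝ) < 1 ∧
      (p n : ℝ) ^ d * (n : ℝ) ^ (d - 1) = Real.log ((n : ℝ) ^ 2 / c)) :
    TendstoInDistribution
      (fun (n : ℕ) (G : SimpleGraph (Fin n)) => remotePairs d G)
      atTop
      (id : ℕ → ℕ)
      (fun n : ℕ => SimpleGraph.binomialRandom (Fin n) (p n))
      (poissonMeasure (c / 2).toNNReal) := by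
  -- Here `m` is the number of interior vertices of a path of length `d`.
  obtain ⟨m, rfl⟩ : ∃ m, d = m + 1 := ⟨d - 1, by omega⟩
  have hmeas : ∀ n, Measurable fun G : SimpleGraph (Fin n) => remotePairs (m + 1) G :=
    fun n => measurable_of_finite _
  refine tendstoInDistribution_nat_of_tendsto_charFun (fun n => (hmeas n).aemeasurable)
    aemeasurable_id fun t => ?_
  rw [Measure.map_id, charFun_map_cast_poissonMeasure, Real.coe_toNNReal _ (by positivity)]
  refine (tendsto_bernoulliMeanC_remoteInd hc (by omega)
    (fun n => ⟨(p n).2.1, (p n).2.2⟩) hp t).congr fun n => ?_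
  rw [charFun_apply, integral_map (by fun_prop) (by fun_prop),
    integral_map (hmeas n).aemeasurable (by fun_prop), integral_binomialRandom]
  congr 1
  ext S
  rw [Real.inner_apply, remotePairs_fromEdgeSet, mul_comm t]
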